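/- **Proposition 2.** Let $\lambda_L,\lambda_R>0$, $\alpha_L,\alpha_R<2$, $\nu_L>0$, $\nu_R>1$, and let $$\mu(y)=\lambda_L\frac{e^{-\nu_L|y|}}{|y|^{1+\alpha_L}}\mathbf 1_{y<0}+\lambda_R\frac{e^{-\nu_R|y|}}{|y|^{1+\alpha_R}}\mathbf 1_{y>0}.$$ For $\beta\in\mathbb R$ let $\nabla=\partial/\partial x$ be the (weak) derivative operator in the complex Hilbert space $L^2_\beta=L^2(\mathbb R,e^{-2\beta x}dx)$, with its maximal domain. For a function $m$, let $m(\nabla)$ be the pseudo-differential operator in $L^2_\beta$ with symbol $m$ and maximal domain: $g=m(\nabla)f$ means $\mathcal F(e^{-\beta x}g)(\xi)=m(\beta+2\pi i\xi)\,\mathcal F(e^{-\beta x}f)(\xi)$ for a.e. $\xi$. Powers and logarithms are principal branches. Write $\mathrm{Re}(A)>0$ if every point of the spectrum of the operator $A$ has positive real part. Assume that $\mathrm{Re}(\nu_R-\nabla)>0$ and $\mathrm{Re}(\nu_L+\nabla)>0$ in $L^2_\beta$. Define, for $\alpha_R,\alpha_L\notin\{0,1\}$, $$\mathcal L_R=\lambda_R\Gamma(-\alpha_R)\{(\nu_R-\nabla)^{\alpha_R}-\nu_R^{\alpha_R}+[\nu_R^{\alpha_R}-(\nu_R-1)^{\alpha_R}]\nabla\},$$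 $$\mathcal L_L=\lambda_L\Gamma(-\alpha_L)\{(\nu_L+\nabla)^{\alpha_L}-\nu_L^{\alpha_L}+[\nu_L^{\alpha_L}-(\nu_L+1)^{\alpha_L}]\nabla\};$$ for $\alpha_R=0$, respectively $\alpha_L=0$, $$\mathcal L_R=\lambda_R\Big\{\log\nu_R-\log(\nu_R-\nabla)+\log\frac{\nu_R-1}{\nu_R}\,\nabla\Big\},\qquad \mathcal L_L=\lambda_L\Big\{\log\nu_L-\log(\nu_L+\nabla)+\log\frac{\nu_L+1}{\nu_L}\,\nabla\Big\};$$ and for $\alpha_R=1$, respectively $\alpha_L=1$, $$\mathcal L_R=\lambda_R\big[(\nu_R-\nabla)\log(\nu_R-\nabla)-\nu_R\log\nu_R+\big(\log(\nu_R-1)-2\nu_R\coth^{-1}(1-2\nu_R)\big)\nabla\big],$$ $$\mathcal L_L=\lambda_L\Big[(\nu_L+\nabla)\log\frac{\nu_L+\nabla}{\nu_L}-(1+\nu_L)\log\frac{\nu_L+1}{\nu_L}\,\nabla\Big].$$ Let $s\ge 1$ with $s>\alpha_L$ and $s>\alpha_R$. Then: 1. Every $f\in L^2_\beta$ with $e^{-\beta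 x}f\in H^s(\mathbb R)$ has a weak derivative $f'$ and lies in the domain of $\mathcal L_R+\mathcal L_L$. For a.e. $x$ the following integral converges absolutely, and $$\int_{-\infty}^{\infty}\big[f(x+y)-f(x)-f'(x)(e^y-1)\big]\mu(y)\,dy=\big((\mathcal L_R+\mathcal L_L)f\big)(x).$$ 2. Consequently, let $T\in\mathbb R$ and let $C(x,\tau)$ be a complex-valued function such that $C(\cdot,\tau)\in L^2_\beta$ and $e^{-\beta x}C(\cdot,\tau)\in H^s(\mathbb R)$ for all $0<\tau<T$. Then $C$ solves the PIDE $$\frac{\partial}{\partial\tau}C(x,\tau)=\int_{-\infty}^{\infty}\Big[C(x+y,\tau)-C(x,\tau)-\frac{\partial}{\partial x}C(x,\tau)(e^y-1)\Big]\mu(y)\,dy$$ if and only if it solves $\frac{\partial}{\partial\tau}C(x,\tau)=(\mathcal L_R+\mathcal L_L)C(x,\tau)$. Both equations are required for every $\tau\in(0,T)$ and a.e. $x$, with a classical derivative in $\tau$ and a weak derivative in $x$. -/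

import Mathlib

open MeasureTheory FourierTransform
open scoped ContDiff SchwartzMap

noncomputable section

/-! ### The exponentially weighted space `L²(ℝ, e^{-2βx} dx)` -/

/-- The measure `e^{-2βx} dx` on `ℝ`. -/
def expMeasure (β : ℝ) : Measure ℝ :=
  volume.withDensity fun x => ENNReal.ofReal (Real.exp (-(2 * β * x)))

/-- The complex Hilbert space `L²(ℝ, e^{-2βx} dx)`; for `β = 0` it is `L²(ℝ)`. -/
abbrev L2exp (β : ℝ) : Type := Lp ℂ 2 (expMeasure β)

theorem volume_absolutelyContinuous_expMeasure (β : ℝ) :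
    (volume : Measure ℝ) ≪ expMeasure β := by
  apply withDensity_absolutelyContinuous'
  · fun_prop
  · exact Filter.Eventually.of_forall fun x => by simp [Real.exp_pos]

theorem expMeasure_absolutelyContinuous_volume (β : ℝ) :
    expMeasure β ≪ (volume : Measure ℝ) :=
  withDensity_absolutelyContinuous _ _

theorem memLp_damp {β : ℝ} {f : ℝ → ℂ} (hf : MemLp f 2 (expMeasure β)) :
    MemLp (fun x => (Real.exp (-(β * x)) : ℂ) * f x) 2 (volume : Measure ℝ) := by
  have h1 : AEStronglyMeasurable f (volume : Measure ℝ) :=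
    hf.1.mono_ac (volume_absolutelyContinuous_expMeasure β)
  have h2 : AEStronglyMeasurable (fun x => (Real.exp (-(β * x)) : ℂ) * f x)
      (volume : Measure ℝ) := by
    refine AEStronglyMeasurable.mul ?_ h1
    exact (by fun_prop : Continuous fun x : ℝ =>
      (Real.exp (-(β * x)) : ℂ)).aestronglyMeasurable
  refine ⟨h2, ?_⟩
  have h3 := hf.2
  rw [eLpNorm_lt_top_iff_lintegral_rpow_enorm_lt_top (by norm_num) (by norm_num)] at h3 ⊢
  rw [expMeasure, lintegral_withDensity_eq_lintegral_mul_non_measurable _ (by fun_prop)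
    (Filter.Eventually.of_forall fun x => ENNReal.ofReal_lt_top)] at h3
  refine lt_of_eq_of_lt (lintegral_congr fun x => ?_) h3
  rw [Pi.mul_apply]
  rw [ENNReal.toReal_ofNat, enorm_mul, ENNReal.mul_rpow_of_nonneg _ _ (by norm_num)]
  congr 1
  have : ‖(Real.exp (-(β * x)) : ℂ)‖ₑ = ENNReal.ofReal (Real.exp (-(β * x))) := by
    rw [← ofReal_norm, Complex.norm_real, Real.norm_of_nonneg (Real.exp_pos _).le]
  rw [this, ENNReal.ofReal_rpow_of_nonneg (Real.exp_pos _).le (by norm_num), ← Real.exp_mul]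
  congr 2
  ring

/-- The unitary map `f ↦ e^{-βx} f` from `L²(ℝ, e^{-2βx} dx)` to `L²(ℝ)`. -/
def damp (β : ℝ) : L2exp β →ₗ[ℂ] Lp ℂ 2 (volume : Measure ℝ) where
  toFun f := (memLp_damp (Lp.memLp f)).toLp _
  map_add' f g := by
    rw [← MemLp.toLp_add, MemLp.toLp_eq_toLp_iff]
    filter_upwards [(volume_absolutelyContinuous_expMeasure β).ae_eq (Lp.coeFn_add f g)] with x hx
    simp only [hx, Pi.add_apply, mul_add]
  map_smul' c f := by
    rw [RingHom.id_apply, ← MemLp.toLp_const_smul, MemLp.toLp_eq_toLp_iff]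
    filter_upwards [(volume_absolutelyContinuous_expMeasure β).ae_eq (Lp.coeFn_smul c f)] with x hx
    simp only [hx, Pi.smul_apply, smul_eq_mul]
    ring

theorem damp_injective (β : ℝ) : Function.Injective (damp β) := by
  intro f g h
  have h' := (MemLp.toLp_eq_toLp_iff (memLp_damp (Lp.memLp f)) (memLp_damp (Lp.memLp g))).1 h
  refine Lp.ext ((expMeasure_absolutelyContinuous_volume β).ae_eq ?_)
  filter_upwards [h'] with x hx
  have : (Real.exp (-(β * x)) : ℂ) ≠ 0 := by exact_mod_cast (Real.exp_pos _).ne'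
  exact mul_left_cancel₀ this hx

/-- The exponentially weighted Sobolev class: `f ∈ L²(e^{-2βx} dx)` and `e^{-βx} f ∈ H^s(ℝ)`. -/
def MemExpSobolev (β s : ℝ) (f : ℝ → ℂ) : Prop :=
  ∃ hf : MemLp f 2 (expMeasure β),
    TemperedDistribution.MemSobolev s 2
      (Lp.toTemperedDistribution (damp β (hf.toLp f)) : 𝓢'(ℝ, ℂ))

/-! ### The derivative -/

/-- `g` is the weak derivative of `f` on `ℝ`. -/
def IsWeakDeriv (f g : ℝ → ℂ) : Prop :=
  LocallyIntegrable f ∧ LocallyIntegrable g ∧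
    ∀ φ : ℝ → ℝ, ContDiff ℝ ∞ φ → HasCompactSupport φ →
      ∫ x, deriv φ x • f x = -∫ x, φ x • g x

theorem IsWeakDeriv.congr {f g f₁ g₁ : ℝ → ℂ} (h : IsWeakDeriv f g)
    (hf : f₁ =ᵐ[volume] f) (hg : g₁ =ᵐ[volume] g) : IsWeakDeriv f₁ g₁ := by
  refine ⟨h.1.congr hf.symm, h.2.1.congr hg.symm, fun φ hφ hc => ?_⟩
  have e1 : ∫ x, deriv φ x • f₁ x = ∫ x, deriv φ x • f x :=
    integral_congr_ae (by filter_upwards [hf] with x hx using by rw [hx])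
  have e2 : ∫ x, φ x • g₁ x = ∫ x, φ x • g x :=
    integral_congr_ae (by filter_upwards [hg] with x hx using by rw [hx])
  rw [e1, e2, h.2.2 φ hφ hc]

theorem IsWeakDeriv.add {f g f₁ g₁ : ℝ → ℂ} (h : IsWeakDeriv f g) (h₁ : IsWeakDeriv f₁ g₁) :
    IsWeakDeriv (f + f₁) (g + g₁) := by
  refine ⟨h.1.add h₁.1, h.2.1.add h₁.2.1, fun φ hφ hc => ?_⟩
  have hd : Continuous (deriv φ) := hφ.continuous_deriv (by simp)
  have i1 := h.1.integrable_smul_left_of_hasCompactSupport hd hc.deriv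
  have i2 := h₁.1.integrable_smul_left_of_hasCompactSupport hd hc.deriv
  have i3 := h.2.1.integrable_smul_left_of_hasCompactSupport hφ.continuous hc
  have i4 := h₁.2.1.integrable_smul_left_of_hasCompactSupport hφ.continuous hc
  simp only [Pi.add_apply, smul_add]
  rw [integral_add i1 i2, integral_add i3 i4, h.2.2 φ hφ hc, h₁.2.2 φ hφ hc, neg_add]

theorem IsWeakDeriv.smul {f g : ℝ → ℂ} (c : ℂ) (h : IsWeakDeriv f g) :
    IsWeakDeriv (c • f) (c • g) := by
  refine ⟨h.1.smul c, h.2.1.smul c, fun φ hφ hc => ?_⟩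
  simp only [Pi.smul_apply, smul_comm _ c]
  rw [integral_smul, integral_smul, h.2.2 φ hφ hc, smul_neg]

/-- The graph of the derivative in `L²(e^{-2βx} dx)`. -/
def gradGraph (β : ℝ) : Submodule ℂ (L2exp β × L2exp β) where
  carrier := {p | IsWeakDeriv p.1 p.2}
  zero_mem' := by
    have h0 : IsWeakDeriv (0 : ℝ → ℂ) 0 :=
      ⟨locallyIntegrable_zero, locallyIntegrable_zero, by simp⟩
    have e := (volume_absolutelyContinuous_expMeasure β).ae_eq
      (Lp.coeFn_zero ℂ 2 (expMeasure β))
    exact h0.congr e e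
  add_mem' {p q} hp hq := (IsWeakDeriv.add hp hq).congr
    ((volume_absolutelyContinuous_expMeasure β).ae_eq (Lp.coeFn_add p.1 q.1))
    ((volume_absolutelyContinuous_expMeasure β).ae_eq (Lp.coeFn_add p.2 q.2))
  smul_mem' c p hp := (IsWeakDeriv.smul c hp).congr
    ((volume_absolutelyContinuous_expMeasure β).ae_eq (Lp.coeFn_smul c p.1))
    ((volume_absolutelyContinuous_expMeasure β).ae_eq (Lp.coeFn_smul c p.2))

theorem gradGraph_functional (β : ℝ) (p : L2exp β × L2exp β) (hp : p ∈ gradGraph β)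
    (h0 : p.1 = 0) : p.2 = 0 := by
  have hw : IsWeakDeriv p.1 p.2 := hp
  have e : (p.1 : ℝ → ℂ) =ᵐ[volume] 0 := by
    rw [h0]
    exact (volume_absolutelyContinuous_expMeasure β).ae_eq (Lp.coeFn_zero ℂ 2 (expMeasure β))
  have hz : (p.2 : ℝ → ℂ) =ᵐ[volume] 0 := by
    refine ae_eq_zero_of_integral_contDiff_smul_eq_zero hw.2.1 fun φ hφ hc => ?_
    have h1 := hw.2.2 φ hφ hc
    have h2 : ∫ x, deriv φ x • p.1 x = 0 := by
      rw [integral_congr_ae (g := fun _ => (0 : ℂ))]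
      · simp
      · filter_upwards [e] with x hx using by simp [hx]
    rw [h2] at h1
    exact neg_eq_zero.1 h1.symm
  refine Lp.ext (((expMeasure_absolutelyContinuous_volume β).ae_eq hz).trans ?_)
  exact (Lp.coeFn_zero ℂ 2 (expMeasure β)).symm

/-- The operator `∇ = ∂/∂x` in `L²(e^{-2βx} dx)`, with the domain of all functions whose weak
derivative lies in this space. -/
def grad (β : ℝ) : L2exp β →ₗ.[ℂ] L2exp β := (gradGraph β).toLinearPMap

/-! ### Spectrum and functional calculus -/

/-- The operator "multiplication by the number `c`". -/
def scalarOp (β c : ℝ) : L2exp β →ₗ.[ℂ] L2exp β :=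
  c • (LinearMap.id : L2exp β →ₗ[ℂ] L2exp β).toPMap ⊤

/-- The spectrum of a partially defined operator: all `z` for which `z - A` has no bounded
everywhere defined inverse. -/
def opSpectrum {E : Type} [NormedAddCommGroup E] [NormedSpace ℂ E] (A : E →ₗ.[ℂ] E) : Set ℂ :=
  {z | ¬ ∃ R : E →L[ℂ] E,
    (∀ g : E, ∃ h : R g ∈ A.domain, z • R g - A ⟨R g, h⟩ = g) ∧
    (∀ f : A.domain, R (z • (f : E) - A f) = f)}

/-- `Re(A) > 0`: all points of the spectrum of `A` have positive real part. -/
def RePos {E : Type} [NormedAddCommGroup E] [NormedSpace ℂ E] (A : E →ₗ.[ℂ] E) : Prop :=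
  ∀ z ∈ opSpectrum A, 0 < z.re

/-- The graph of `m(∇)`. Here `ξ ↦ 𝓕(e^{-βx} f)(ξ)` are the coefficients of `f` with respect to
the generalized eigenfunctions `e^{(β + 2πiξ)x}` of `∇`. -/
def fnGraph (β : ℝ) (m : ℂ → ℂ) : Submodule ℂ (L2exp β × L2exp β) where
  carrier := {p | ∀ᵐ ξ : ℝ, (𝓕 (damp β p.2) : Lp ℂ 2 (volume : Measure ℝ)) ξ =
    m (β + 2 * Real.pi * ξ * Complex.I) * (𝓕 (damp β p.1) : Lp ℂ 2 (volume : Measure ℝ)) ξ}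
  zero_mem' := by
    have h0 : (𝓕 (0 : Lp ℂ 2 (volume : Measure ℝ)) : Lp ℂ 2 (volume : Measure ℝ)) = 0 :=
      (Lp.fourierTransformₗᵢ ℝ ℂ).map_zero
    simp only [Set.mem_ofPred_eq, Prod.fst_zero, Prod.snd_zero, map_zero, h0]
    filter_upwards [Lp.coeFn_zero ℂ 2 (volume : Measure ℝ)] with ξ hξ
    rw [hξ, Pi.zero_apply, mul_zero]
  add_mem' {p q} hp hq := by
    have ha : ∀ u v : Lp ℂ 2 (volume : Measure ℝ),
        (𝓕 (u + v) : Lp ℂ 2 (volume : Measure ℝ)) = 𝓕 u + 𝓕 v :=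
      (Lp.fourierTransformₗᵢ ℝ ℂ).map_add
    simp only [Set.mem_ofPred_eq, Prod.fst_add, Prod.snd_add, map_add, ha] at hp hq ⊢
    filter_upwards [hp, hq, Lp.coeFn_add (𝓕 (damp β p.1)) (𝓕 (damp β q.1)),
      Lp.coeFn_add (𝓕 (damp β p.2)) (𝓕 (damp β q.2))] with ξ h1 h2 h3 h4
    rw [h3, h4, Pi.add_apply, Pi.add_apply, h1, h2, mul_add]
  smul_mem' c p hp := by
    simp only [Set.mem_ofPred_eq, Prod.smul_fst, Prod.smul_snd, map_smul, fourier_smul] at hp ⊢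
    filter_upwards [hp, Lp.coeFn_smul c (𝓕 (damp β p.1)),
      Lp.coeFn_smul c (𝓕 (damp β p.2))] with ξ h1 h3 h4
    rw [h3, h4, Pi.smul_apply, Pi.smul_apply, h1, smul_eq_mul, smul_eq_mul]
    ring

theorem fnGraph_functional (β : ℝ) (m : ℂ → ℂ) (p : L2exp β × L2exp β) (hp : p ∈ fnGraph β m)
    (h0 : p.1 = 0) : p.2 = 0 := by
  have hp' : ∀ᵐ ξ : ℝ, (𝓕 (damp β p.2) : Lp ℂ 2 (volume : Measure ℝ)) ξ =
    m (β + 2 * Real.pi * ξ * Complex.I) *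
      (𝓕 (damp β p.1) : Lp ℂ 2 (volume : Measure ℝ)) ξ := hp
  have hz : (𝓕 (0 : Lp ℂ 2 (volume : Measure ℝ)) : Lp ℂ 2 (volume : Measure ℝ)) = 0 :=
    (Lp.fourierTransformₗᵢ ℝ ℂ).map_zero
  rw [h0, map_zero, hz] at hp'
  have h1 : (𝓕 (damp β p.2) : Lp ℂ 2 (volume : Measure ℝ)) = 0 := by
    refine Lp.ext ?_
    filter_upwards [hp', Lp.coeFn_zero ℂ 2 (volume : Measure ℝ)] with ξ h2 h3
    rw [h2, h3]
    simp
  have h2 : damp β p.2 = 0 :=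
    (Lp.fourierTransformₗᵢ ℝ ℂ).injective (h1.trans hz.symm)
  exact damp_injective β (h2.trans (map_zero _).symm)

/-- The function `m(∇)` of the operator `∇` in `L²(e^{-2βx} dx)`, i.e. the pseudo-differential
operator with symbol `m`, with its maximal domain. -/
def fnOp (β : ℝ) (m : ℂ → ℂ) : L2exp β →ₗ.[ℂ] L2exp β := (fnGraph β m).toLinearPMap

/-! ### The jump operators of the tempered stable model -/

/-- The inverse hyperbolic cotangent, for `|x| > 1`. -/
def arcoth (x : ℝ) : ℝ := Real.artanh x⁻¹

/-- The operator `𝓛_R` (positive jumps). -/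
def opR (β lam ν α : ℝ) : L2exp β →ₗ.[ℂ] L2exp β :=
  open scoped Classical in
  if α = 0 then
    lam • (scalarOp β (Real.log ν) - fnOp β (fun z => Complex.log (ν - z))
      + Real.log ((ν - 1) / ν) • grad β)
  else if α = 1 then
    lam • (fnOp β (fun z => (ν - z) * Complex.log (ν - z)) - scalarOp β (ν * Real.log ν)
      + (Real.log (ν - 1) - 2 * ν * arcoth (1 - 2 * ν)) • grad β)
  else
    (lam * Real.Gamma (-α)) • (fnOp β (fun z => (ν - z) ^ (α : ℂ)) - scalarOp β (ν ^ α)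
      + (ν ^ α - (ν - 1) ^ α) • grad β)

/-- The operator `𝓛_L` (negative jumps). -/
def opL (β lam ν α : ℝ) : L2exp β →ₗ.[ℂ] L2exp β :=
  open scoped Classical in
  if α = 0 then
    lam • (scalarOp β (Real.log ν) - fnOp β (fun z => Complex.log (ν + z))
      + Real.log ((ν + 1) / ν) • grad β)
  else if α = 1 then
    lam • (fnOp β (fun z => (ν + z) * Complex.log ((ν + z) / ν))
      - ((1 + ν) * Real.log ((ν + 1) / ν)) • grad β)
  else
    (lam * Real.Gamma (-α)) • (fnOp β (fun z => (ν + z) ^ (α : ℂ)) - scalarOp β (ν ^ α)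
      + (ν ^ α - (ν + 1) ^ α) • grad β)

/-- The density of the Lévy measure of the generalized tempered stable process. -/
def levyDensity (lamL νL αL lamR νR αR : ℝ) (y : ℝ) : ℝ :=
  open scoped Classical in
  (if y < 0 then lamL * (Real.exp (-(νL * |y|)) / |y| ^ (1 + αL)) else 0) +
    (if 0 < y then lamR * (Real.exp (-(νR * |y|)) / |y| ^ (1 + αR)) else 0)

/-- The integrand `[f(x+y) - f(x) - f'(x) (e^y - 1)] μ(y)` of the jump integral, where `μ` is a
density and `f'` is the derivative of `f`. -/
def jumpIntegrand (μ : ℝ → ℝ) (f f' : ℝ → ℂ) (x y : ℝ) : ℂ :=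
  (f (x + y) - f x - f' x * (Real.exp y - 1 : ℝ)) * (μ y : ℂ)

/-- `C` (a function of time `τ` and position `x`) solves on `0 < τ < T` the equation
`∂C/∂τ = ∫ [C(x+y,τ) - C(x,τ) - ∂C/∂x(x,τ) (e^y - 1)] μ(y) dy`, the integral being absolutely
convergent. -/
def SolvesPIDE (μ : ℝ → ℝ) (T : ℝ) (C : ℝ → ℝ → ℂ) : Prop :=
  ∀ τ ∈ Set.Ioo 0 T, ∃ D : ℝ → ℂ, IsWeakDeriv (C τ) D ∧
    ∀ᵐ x : ℝ, Integrable (jumpIntegrand μ (C τ) D x) ∧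
      HasDerivAt (fun t => C t x) (∫ y, jumpIntegrand μ (C τ) D x y) τ

/-- `C` solves on `0 < τ < T` the equation `∂C/∂τ = A C`, where `A` is an operator in
`L²(e^{-2βx} dx)` acting on the space variable. -/
def SolvesPDE {β : ℝ} (A : L2exp β →ₗ.[ℂ] L2exp β) (T : ℝ) (C : ℝ → ℝ → ℂ) : Prop :=
  ∀ τ ∈ Set.Ioo 0 T, ∃ (hC : MemLp (C τ) 2 (expMeasure β)) (hA : hC.toLp (C τ) ∈ A.domain),
    ∀ᵐ x : ℝ, HasDerivAt (fun t => C t x) ((A ⟨hC.toLp (C τ), hA⟩ : ℝ → ℂ) x) τ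

end

noncomputable section

/-! ### The Fourier transform on `L²(ℝ)` tested against Schwartz functions -/

/-! After multiplication by `e^{-βx}` the Fourier transform diagonalises `∇` as multiplication by `z
= β + 2πiξ`. For fixed `y` the compensated translation `f(x+y) - f(x) - f'(x)(e^y - 1)` becomes
multiplication by `e^{zy} - 1 - z(e^y - 1)`. Part 1 therefore amounts to integrating this symbol
against `μ` in closed form and to justifying the interchange of the `y`-integral with the Fourier
transform.

Closed form: on each half-line, Taylor's formula `e^w - 1 - w = ∫₀¹ (1-t) w² e^{tw} dt` brings out a
factor `y²`, which makes the Gamma integral converge for every `α < 2` and gives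
`Γ(2-α)(ν-z)^{α-2}`. Any second antiderivative `F` of this function then expresses the symbol
(`integral_cexp_sub_mul_tsDensity`, `integral_compensated_mul_tsDensity`). Power, logarithm and
`(ν-z) log (ν-z)` are the three choices of `F` for generic `α`, `α = 0` and `α = 1`.

Convergence: `β` is an approximate eigenvalue of `∇`, so the spectral hypotheses force `-ν_L < β <
ν_R`, and the line `Re z = β` lies where these integrals converge.

Interchange: the symbol is at most `jumpWeight β σ y * (1 + ‖z‖)^σ` for `1 ≤ σ ≤ 2`
(`norm_jumpSymbol_le`). With `σ = min s 2` the weight is `μ`-integrable and `(1 + ‖z‖)^σ` is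
absorbed by the Sobolev hypothesis. Plancherel and Fubini against test functions then identify the
jump integral (`ae_integral_dampedJump_eq`).

Part 2 applies Part 1 at each `τ`, since weak derivatives are unique almost everywhere. -/

/-- Duality with `φ = 𝓕 (𝓕⁻ φ)`. Translations and derivatives of `L²` functions are transferred to
the Schwartz function, where their transforms are computed pointwise. -/
theorem integral_schwartz_mul_eq_integral_fourierInv_mul_fourier
    (u : Lp ℂ 2 (volume : Measure ℝ)) (φ : 𝓢(ℝ, ℂ)) :
    ∫ x, φ x * u x = ∫ ξ, (𝓕⁻ φ) ξ * (𝓕 u : Lp ℂ 2 (volume : Measure ℝ)) ξ := by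
  have h := congrArg (fun T : 𝓢'(ℝ, ℂ) => T (𝓕⁻ φ)) (Lp.fourier_toTemperedDistribution_eq u)
  simp only [TemperedDistribution.fourier_apply, fourier_fourierInv_eq,
    Lp.toTemperedDistribution_apply, smul_eq_mul] at h
  exact h

theorem Lp_eq_of_integral_schwartz_mul_eq {u w : Lp ℂ 2 (volume : Measure ℝ)}
    (h : ∀ φ : 𝓢(ℝ, ℂ), ∫ x, φ x * u x = ∫ x, φ x * w x) : u = w := by
  have hk := Lp.ker_toTemperedDistributionCLM_eq_bot (F := ℂ) (μ := (volume : Measure ℝ)) (p := 2)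
  refine LinearMap.ker_eq_bot.1 hk ?_
  ext φ
  simpa [smul_eq_mul] using h φ

theorem fourier_eq_of_integral_schwartz_mul_eq {u w : Lp ℂ 2 (volume : Measure ℝ)}
    (h : ∀ φ : 𝓢(ℝ, ℂ), ∫ x, φ x * u x = ∫ ξ, (𝓕⁻ φ) ξ * w ξ) : 𝓕 u = w := by
  refine Lp_eq_of_integral_schwartz_mul_eq fun φ => ?_
  have h1 := h (𝓕 φ)
  rw [integral_schwartz_mul_eq_integral_fourierInv_mul_fourier, fourierInv_fourier_eq] at h1
  exact h1

theorem fourierInv_compSubConst_apply (φ : 𝓢(ℝ, ℂ)) (y ξ : ℝ) :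
    (𝓕⁻ (SchwartzMap.compSubConstCLM ℂ y φ)) ξ
      = Complex.exp (2 * Real.pi * ξ * Complex.I * y) * (𝓕⁻ φ) ξ := by
  rw [SchwartzMap.fourierInv_coe, SchwartzMap.fourierInv_coe, Real.fourierInv_eq',
    Real.fourierInv_eq', ← integral_const_mul, ← integral_add_right_eq_self _ y]
  refine integral_congr_ae (Filter.Eventually.of_forall fun x => ?_)
  simp only [SchwartzMap.compSubConstCLM_apply, add_sub_cancel_right, smul_eq_mul, ← mul_assoc,
    ← Complex.exp_add, RCLike.inner_apply, conj_trivial]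
  congr 2
  push_cast
  ring

theorem fourierInv_deriv_apply (φ : 𝓢(ℝ, ℂ)) (ξ : ℝ) :
    (𝓕⁻ (SchwartzMap.derivCLM ℂ ℂ φ)) ξ
      = -(2 * Real.pi * ξ * Complex.I) * (𝓕⁻ φ) ξ := by
  have h : SchwartzMap.derivCLM ℂ ℂ φ = LineDeriv.lineDerivOp (1 : ℝ) φ := by
    ext x
    simp [SchwartzMap.lineDerivOp_apply_eq_fderiv]
  have ht : (fun x : ℝ => inner ℝ x (1 : ℝ)).HasTemperateGrowth := by fun_prop
  rw [h, SchwartzMap.fourierInv_lineDerivOp_eq, smul_apply,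
    SchwartzMap.smulLeftCLM_apply_apply ht]
  simp
  ring

/-- The Sobolev condition is an identity of tempered distributions. Both sides are locally
integrable functions, so compactly supported smooth tests turn it into an identity almost
everywhere. -/
theorem memLp_rpow_mul_fourier_of_memSobolev {s : ℝ} {u : Lp ℂ 2 (volume : Measure ℝ)}
    (h : TemperedDistribution.MemSobolev s 2 (Lp.toTemperedDistribution u : 𝓢'(ℝ, ℂ))) :
    MemLp (fun ξ : ℝ => (((1 + ξ ^ 2) ^ (s / 2) : ℝ) : ℂ)
      * (𝓕 u : Lp ℂ 2 (volume : Measure ℝ)) ξ) 2 := by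
  obtain ⟨w, hw⟩ := TemperedDistribution.memSobolev_iff_exists_smulLeftCLM_fourier.1 h
  have ht : (fun x : ℝ => (((1 + ‖x‖ ^ 2) ^ (s / 2) : ℝ) : ℂ)).HasTemperateGrowth := by fun_prop
  refine (Lp.memLp w).ae_eq ?_
  have hc : Continuous fun ξ : ℝ => (((1 + ξ ^ 2) ^ (s / 2) : ℝ) : ℂ) := by
    simpa using ht.1.continuous
  refine ae_eq_of_integral_contDiff_smul_eq ((Lp.memLp w).locallyIntegrable (by norm_num)) ?_ ?_
  · exact ((Lp.memLp (𝓕 u)).locallyIntegrable (by norm_num)).continuous_mul hc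
  intro g hg hgc
  have hg₁ : HasCompactSupport (Complex.ofRealCLM ∘ g) := hgc.comp_left rfl
  have hg₂ : ContDiff ℝ ∞ (Complex.ofRealCLM ∘ g) := by fun_prop
  have h1 := congrArg (fun T : 𝓢'(ℝ, ℂ) => T (hg₁.toSchwartzMap hg₂)) hw
  rw [Lp.fourier_toTemperedDistribution_eq] at h1
  simp only [TemperedDistribution.smulLeftCLM_apply_apply, Lp.toTemperedDistribution_apply,
    SchwartzMap.smulLeftCLM_apply_apply ht] at h1
  simp only [HasCompactSupport.toSchwartzMap_toFun, Function.comp_apply, smul_eq_mul] at h1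
  simpa [mul_comm, mul_left_comm, mul_assoc] using h1.symm

/-! ### Surjectivity of the damping map -/

theorem memLp_undamp {β : ℝ} {v : ℝ → ℂ} (hv : MemLp v 2 (volume : Measure ℝ)) :
    MemLp (fun x => (Real.exp (β * x) : ℂ) * v x) 2 (expMeasure β) := by
  have h2 : AEStronglyMeasurable (fun x => (Real.exp (β * x) : ℂ) * v x) (volume : Measure ℝ) :=
    (by fun_prop : Continuous fun x : ℝ =>
      (Real.exp (β * x) : ℂ)).aestronglyMeasurable.mul hv.1
  refine ⟨h2.mono_ac (expMeasure_absolutelyContinuous_volume β), ?_⟩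
  have h3 := hv.2
  rw [eLpNorm_lt_top_iff_lintegral_rpow_enorm_lt_top (by norm_num) (by norm_num)] at h3 ⊢
  rw [expMeasure, lintegral_withDensity_eq_lintegral_mul_non_measurable _ (by fun_prop)
    (Filter.Eventually.of_forall fun x => ENNReal.ofReal_lt_top)]
  refine lt_of_eq_of_lt (lintegral_congr fun x => ?_) h3
  rw [Pi.mul_apply, ENNReal.toReal_ofNat, enorm_mul, ENNReal.mul_rpow_of_nonneg _ _ (by norm_num),
    ← mul_assoc]
  have : ‖(Real.exp (β * x) : ℂ)‖ₑ = ENNReal.ofReal (Real.exp (β * x)) := by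
    rw [← ofReal_norm, Complex.norm_real, Real.norm_of_nonneg (Real.exp_pos _).le]
  rw [this, ENNReal.ofReal_rpow_of_nonneg (Real.exp_pos _).le (by norm_num), ← Real.exp_mul,
    ← ENNReal.ofReal_mul (Real.exp_pos _).le, ← Real.exp_add]
  ring_nf
  simp

theorem coeFn_damp {β : ℝ} (f : L2exp β) :
    (damp β f : ℝ → ℂ) =ᵐ[volume] fun x => (Real.exp (-(β * x)) : ℂ) * f x :=
  (memLp_damp (Lp.memLp f)).coeFn_toLp

/-- Needed to construct elements of `L2exp β` from prescribed Fourier coefficients. -/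
theorem damp_surjective (β : ℝ) : Function.Surjective (damp β) := by
  intro v
  have hv := memLp_undamp (β := β) (Lp.memLp v)
  refine ⟨hv.toLp _, Lp.ext ?_⟩
  filter_upwards [coeFn_damp (hv.toLp _),
    (volume_absolutelyContinuous_expMeasure β).ae_eq hv.coeFn_toLp] with x h1 h2
  rw [h1, h2, ← mul_assoc, ← Complex.ofReal_mul, ← Real.exp_add]
  simp

theorem eLpNorm_damp (β : ℝ) (f : ℝ → ℂ) :
    eLpNorm (fun x => (Real.exp (-(β * x)) : ℂ) * f x) 2 volume = eLpNorm f 2 (expMeasure β) := by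
  rw [eLpNorm_eq_lintegral_rpow_enorm_toReal (by norm_num) (by norm_num),
    eLpNorm_eq_lintegral_rpow_enorm_toReal (by norm_num) (by norm_num)]
  congr 1
  rw [expMeasure, lintegral_withDensity_eq_lintegral_mul_non_measurable _ (by fun_prop)
    (Filter.Eventually.of_forall fun x => ENNReal.ofReal_lt_top)]
  refine lintegral_congr fun x => ?_
  rw [Pi.mul_apply, ENNReal.toReal_ofNat, enorm_mul, ENNReal.mul_rpow_of_nonneg _ _ (by norm_num)]
  congr 1
  have : ‖(Real.exp (-(β * x)) : ℂ)‖ₑ = ENNReal.ofReal (Real.exp (-(β * x))) := by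
    rw [← ofReal_norm, Complex.norm_real, Real.norm_of_nonneg (Real.exp_pos _).le]
  rw [this, ENNReal.ofReal_rpow_of_nonneg (Real.exp_pos _).le (by norm_num), ← Real.exp_mul]
  congr 2
  ring

theorem norm_damp {β : ℝ} (f : L2exp β) : ‖damp β f‖ = ‖f‖ := by
  rw [Lp.norm_def, Lp.norm_def, eLpNorm_congr_ae (coeFn_damp f), eLpNorm_damp]

/-! ### Graphs of functions of the derivative -/

theorem mem_fnGraph_iff {β : ℝ} {m : ℂ → ℂ} {f g : L2exp β} :
    (f, g) ∈ fnGraph β m ↔ ∀ᵐ ξ : ℝ, (𝓕 (damp β g) : Lp ℂ 2 (volume : Measure ℝ)) ξ =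
      m (β + 2 * Real.pi * ξ * Complex.I) *
        (𝓕 (damp β f) : Lp ℂ 2 (volume : Measure ℝ)) ξ := Iff.rfl

theorem exists_fourier_damp_ae_eq (β : ℝ) {w : ℝ → ℂ} (hw : MemLp w 2 (volume : Measure ℝ)) :
    ∃ g : L2exp β, (𝓕 (damp β g) : Lp ℂ 2 (volume : Measure ℝ)) =ᵐ[volume] w := by
  obtain ⟨g, hg⟩ := damp_surjective β (𝓕⁻ (hw.toLp w))
  refine ⟨g, ?_⟩
  rw [hg, fourier_fourierInv_eq]
  exact hw.coeFn_toLp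

theorem exists_mem_fnGraph {β : ℝ} {m : ℂ → ℂ} {f : L2exp β}
    (h : MemLp (fun ξ : ℝ => m (β + 2 * Real.pi * ξ * Complex.I) *
      (𝓕 (damp β f) : Lp ℂ 2 (volume : Measure ℝ)) ξ) 2) : ∃ g, (f, g) ∈ fnGraph β m :=
  exists_fourier_damp_ae_eq β h

/-- Only the line `Re z = β` matters, so closed forms valid merely on a half-plane containing it may
be substituted. -/
theorem fnGraph_congr {β : ℝ} {m m' : ℂ → ℂ} {f g : L2exp β} (h : (f, g) ∈ fnGraph β m)
    (hm : ∀ z : ℂ, z.re = β → m z = m' z) : (f, g) ∈ fnGraph β m' := by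
  rw [mem_fnGraph_iff] at h ⊢
  filter_upwards [h] with ξ hξ
  rw [hξ, hm _ (by simp)]

theorem fnGraph_add {β : ℝ} {m m' : ℂ → ℂ} {f g g' : L2exp β} (h : (f, g) ∈ fnGraph β m)
    (h' : (f, g') ∈ fnGraph β m') : (f, g + g') ∈ fnGraph β (fun z => m z + m' z) := by
  rw [mem_fnGraph_iff] at h h' ⊢
  rw [map_add, FourierTransform.fourier_add]
  filter_upwards [h, h', Lp.coeFn_add (𝓕 (damp β g)) (𝓕 (damp β g'))] with ξ h1 h2 h3
  rw [h3, Pi.add_apply, h1, h2, add_mul]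

theorem fnGraph_smul {β : ℝ} {m : ℂ → ℂ} {f g : L2exp β} (c : ℂ) (h : (f, g) ∈ fnGraph β m) :
    (f, c • g) ∈ fnGraph β (fun z => c * m z) := by
  rw [mem_fnGraph_iff] at h ⊢
  rw [map_smul, fourier_smul]
  filter_upwards [h, Lp.coeFn_smul c (𝓕 (damp β g))] with ξ h1 h3
  rw [h3, Pi.smul_apply, h1, smul_eq_mul]
  ring

theorem fnGraph_one {β : ℝ} (f : L2exp β) : (f, f) ∈ fnGraph β (fun _ => 1) := by
  rw [mem_fnGraph_iff]
  simp

theorem gradGraph_of_fnGraph {β : ℝ} {f g : L2exp β} (h : (f, g) ∈ fnGraph β fun z => z) :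
    (f, g) ∈ gradGraph β := by
  rw [mem_fnGraph_iff] at h
  have hloc : ∀ q : L2exp β, LocallyIntegrable (q : ℝ → ℂ) := by
    intro q
    have h1 : LocallyIntegrable (fun x => (Real.exp (β * x) : ℂ) * damp β q x) :=
      ((Lp.memLp (damp β q)).locallyIntegrable (by norm_num)).continuous_mul (by fun_prop)
    refine h1.congr ?_
    filter_upwards [coeFn_damp q] with x hx
    rw [hx, ← mul_assoc, ← Complex.ofReal_mul, ← Real.exp_add]
    simp
  refine ⟨hloc f, hloc g, fun χ hχ hc => ?_⟩
  -- The factor `e^{βx}` cancels the damping, so pairing `φ` with `damp β g` is pairing `χ` with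
  -- `g`. Below, `Ψ = βΦ - Φ' = -e^{βx} χ'`, and its inverse transform is `(β + 2πiξ) 𝓕⁻ Φ`.
  set φ : ℝ → ℂ := fun x => (Real.exp (β * x) * χ x : ℝ) with hφdef
  have hφ₁ : HasCompactSupport φ := by
    have h1 : HasCompactSupport fun x => Real.exp (β * x) * χ x := hc.mul_left
    exact h1.comp_left (g := Complex.ofReal) rfl
  have hφ₂ : ContDiff ℝ ∞ φ := by
    have : ContDiff ℝ ∞ fun x => Real.exp (β * x) * χ x := by fun_prop
    exact Complex.ofRealCLM.contDiff.comp this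
  set Φ : 𝓢(ℝ, ℂ) := hφ₁.toSchwartzMap hφ₂ with hΦ
  set Ψ : 𝓢(ℝ, ℂ) := (β : ℂ) • Φ - SchwartzMap.derivCLM ℂ ℂ Φ with hΨ
  have hΨx : ∀ x, Ψ x = -(Real.exp (β * x) * deriv χ x : ℝ) := by
    intro x
    have hd : HasDerivAt (fun x => Real.exp (β * x) * χ x)
        (β * Real.exp (β * x) * χ x + Real.exp (β * x) * deriv χ x) x := by
      have h1 : HasDerivAt (fun x => Real.exp (β * x)) (β * Real.exp (β * x)) x := by
        have := ((hasDerivAt_id x).const_mul β).exp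
        simpa [mul_comm] using this
      exact h1.mul ((hχ.differentiable (by simp)) x).hasDerivAt
    have hd' : deriv Φ x = ((β * Real.exp (β * x) * χ x + Real.exp (β * x) * deriv χ x : ℝ) : ℂ) :=
      hd.ofReal_comp.deriv
    have h3 : Ψ x = β * φ x - deriv Φ x := by
      simp [hΨ, SchwartzMap.derivCLM_apply, hΦ]
    rw [h3, hd', hφdef]
    push_cast
    ring
  have e1 := integral_schwartz_mul_eq_integral_fourierInv_mul_fourier (damp β g) Φ
  have e2 := integral_schwartz_mul_eq_integral_fourierInv_mul_fourier (damp β f) Ψ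
  have e3 : ∫ ξ, (𝓕⁻ Φ) ξ * (𝓕 (damp β g) : Lp ℂ 2 (volume : Measure ℝ)) ξ =
      ∫ ξ, (𝓕⁻ Ψ) ξ * (𝓕 (damp β f) : Lp ℂ 2 (volume : Measure ℝ)) ξ := by
    refine integral_congr_ae ?_
    filter_upwards [h] with ξ hξ
    have : (𝓕⁻ Ψ) ξ = (β + 2 * Real.pi * ξ * Complex.I) * (𝓕⁻ Φ) ξ := by
      have h0 : 𝓕⁻ Ψ = (β : ℂ) • 𝓕⁻ Φ - 𝓕⁻ (SchwartzMap.derivCLM ℂ ℂ Φ) := by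
        rw [hΨ, sub_eq_add_neg, FourierTransform.fourierInv_add, FourierTransform.fourierInv_neg,
          FourierTransform.fourierInv_smul, ← sub_eq_add_neg]
      rw [h0, sub_apply, smul_apply, fourierInv_deriv_apply, smul_eq_mul]
      ring
    rw [hξ, this]
    ring
  rw [e3, ← e2] at e1
  have e4 : ∫ x, Φ x * damp β g x = ∫ x, χ x • g x := by
    refine integral_congr_ae ?_
    filter_upwards [coeFn_damp g] with x hx
    have : Φ x = (Real.exp (β * x) * χ x : ℝ) := rfl
    rw [hx, this, Complex.real_smul, Complex.ofReal_mul]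
    calc _ = ((Real.exp (β * x) * Real.exp (-(β * x)) : ℝ) : ℂ) * (χ x * g x) := by
          push_cast; ring
      _ = _ := by rw [← Real.exp_add]; simp
  have e5 : ∫ x, Ψ x * damp β f x = -∫ x, deriv χ x • f x := by
    rw [← integral_neg]
    refine integral_congr_ae ?_
    filter_upwards [coeFn_damp f] with x hx
    rw [hx, hΨx, Complex.real_smul]
    calc _ = -((Real.exp (β * x) * Real.exp (-(β * x)) : ℝ) : ℂ) * (deriv χ x * f x) := by
          push_cast; ring
      _ = _ := by rw [← Real.exp_add]; simp
  rw [e4, e5] at e1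
  rw [e1, neg_neg]

/-! ### Graphs of sums and multiples of partially defined operators -/

section Graph

variable {E : Type*} [AddCommGroup E] [Module ℂ E] {A B : E →ₗ.[ℂ] E} {x y y' : E}

/-- Operators are handled through graphs: a pair in a graph carries its domain membership, which for
a sum is membership in both domains. -/
theorem mem_graph_add (h : (x, y) ∈ A.graph) (h' : (x, y') ∈ B.graph) :
    (x, y + y') ∈ (A + B).graph := by
  rw [LinearPMap.mem_graph_iff] at *
  obtain ⟨a, rfl, rfl⟩ := h
  obtain ⟨b, hb, rfl⟩ := h'
  have hb' : (b : E) = a := hb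
  refine ⟨⟨a, a.2, hb' ▸ b.2⟩, rfl, ?_⟩
  rw [LinearPMap.add_apply]
  congr 2
  exact Subtype.ext hb.symm

theorem mem_graph_sub (h : (x, y) ∈ A.graph) (h' : (x, y') ∈ B.graph) :
    (x, y - y') ∈ (A - B).graph := by
  rw [LinearPMap.mem_graph_iff] at *
  obtain ⟨a, rfl, rfl⟩ := h
  obtain ⟨b, hb, rfl⟩ := h'
  have hb' : (b : E) = a := hb
  refine ⟨⟨a, a.2, hb' ▸ b.2⟩, rfl, ?_⟩
  rw [LinearPMap.sub_apply]
  congr 2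
  exact Subtype.ext hb.symm

theorem mem_graph_real_smul [Module ℝ E] [IsScalarTower ℝ ℂ E] [SMulCommClass ℂ ℝ E] (c : ℝ)
    (h : (x, y) ∈ A.graph) :
    (x, (c : ℂ) • y) ∈ (c • A).graph := by
  rw [LinearPMap.mem_graph_iff] at *
  obtain ⟨a, rfl, rfl⟩ := h
  exact ⟨a, rfl, by rw [LinearPMap.smul_apply, ← Complex.coe_algebraMap, algebraMap_smul]⟩

end Graph

theorem mem_graph_scalarOp {β : ℝ} (c : ℝ) (f : L2exp β) :
    (f, (c : ℂ) • f) ∈ (scalarOp β c).graph :=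
  mem_graph_real_smul c ((LinearPMap.mem_graph_iff _).2 ⟨⟨f, trivial⟩, rfl, rfl⟩)

theorem mem_graph_fnOp {β : ℝ} {m : ℂ → ℂ} {f g : L2exp β} (h : (f, g) ∈ fnGraph β m) :
    (f, g) ∈ (fnOp β m).graph := by
  rwa [fnOp, Submodule.toLinearPMap_graph_eq _ (fnGraph_functional β m)]

theorem mem_graph_grad {β : ℝ} {f g : L2exp β} (h : (f, g) ∈ fnGraph β fun z => z) :
    (f, g) ∈ (grad β).graph := by
  rw [grad, Submodule.toLinearPMap_graph_eq _ (gradGraph_functional β)]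
  exact gradGraph_of_fnGraph h

/-! ### The spectrum of the derivative -/

/-- A bounded left inverse `R` of `z - A` forces `‖x‖ ≤ ‖R‖ ‖zx - Ax‖`, which fails for `ε = (‖R‖ +
1)⁻¹`. -/
theorem mem_opSpectrum_of_approximate_eigenvectors {E : Type} [NormedAddCommGroup E]
    [NormedSpace ℂ E] {A : E →ₗ.[ℂ] E} {z : ℂ}
    (h : ∀ ε > 0, ∃ x y : E, (x, y) ∈ A.graph ∧ x ≠ 0 ∧ ‖z • x - y‖ ≤ ε * ‖x‖) :
    z ∈ opSpectrum A := by
  rintro ⟨R, -, hR⟩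
  have hpos : 0 < ‖R‖ + 1 := by positivity
  obtain ⟨x, y, hxy, hx0, hle⟩ := h (‖R‖ + 1)⁻¹ (inv_pos.2 hpos)
  obtain ⟨a, rfl, rfl⟩ := (LinearPMap.mem_graph_iff _).1 hxy
  have h1 : ‖(a : E)‖ ≤ ‖R‖ * ((‖R‖ + 1)⁻¹ * ‖(a : E)‖) := by
    calc ‖(a : E)‖ = ‖R (z • (a : E) - A a)‖ := by rw [hR a]
      _ ≤ ‖R‖ * ‖z • (a : E) - A a‖ := R.le_opNorm _
      _ ≤ _ := by gcongr
  have h2 : 0 < ‖(a : E)‖ := norm_pos_iff.2 hx0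
  have h3 : ‖R‖ * (‖R‖ + 1)⁻¹ < 1 := by
    rw [← div_eq_mul_inv, div_lt_one hpos]
    linarith
  nlinarith

/-- Take `f` with Fourier coefficients the indicator of `[0, δ]`; there `z - β = 2πiξ` has modulus
at most `2πδ = ε`. -/
theorem exists_approximate_eigenvector_grad (β : ℝ) {ε : ℝ} (hε : 0 < ε) :
    ∃ f g : L2exp β, (f, g) ∈ (grad β).graph ∧ f ≠ 0 ∧ ‖g - (β : ℂ) • f‖ ≤ ε * ‖f‖ := by
  obtain ⟨δ, hδ0, hδ⟩ : ∃ δ : ℝ, 0 < δ ∧ 2 * Real.pi * δ = ε :=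
    ⟨ε / (2 * Real.pi), by positivity, by field_simp⟩
  have hw : MemLp ((Set.Icc 0 δ).indicator fun _ : ℝ => (1 : ℂ)) 2 :=
    memLp_indicator_const 2 measurableSet_Icc _ (Or.inr (by simp))
  obtain ⟨f, hf⟩ := exists_fourier_damp_ae_eq β hw
  have hb : ∀ᵐ ξ : ℝ, ‖(fun z : ℂ => z - β) (β + 2 * Real.pi * ξ * Complex.I) *
      (𝓕 (damp β f) : Lp ℂ 2 (volume : Measure ℝ)) ξ‖ ≤
      ε * ‖(𝓕 (damp β f) : Lp ℂ 2 (volume : Measure ℝ)) ξ‖ := by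
    filter_upwards [hf] with ξ hξ
    rw [norm_mul, hξ]
    by_cases hmem : ξ ∈ Set.Icc 0 δ
    · refine mul_le_mul_of_nonneg_right ?_ (norm_nonneg _)
      simp only [add_sub_cancel_left, norm_mul, Complex.norm_I, Complex.norm_real,
        Complex.norm_ofNat, Real.norm_eq_abs, abs_of_pos Real.pi_pos, abs_of_nonneg hmem.1, mul_one]
      calc 2 * Real.pi * ξ ≤ 2 * Real.pi * δ :=
            mul_le_mul_of_nonneg_left hmem.2 (by positivity)
        _ = ε := hδ
    · simp [Set.indicator_of_notMem hmem]
  have hz : MemLp (fun ξ : ℝ => (fun z : ℂ => z - β) (β + 2 * Real.pi * ξ * Complex.I) *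
      (𝓕 (damp β f) : Lp ℂ 2 (volume : Measure ℝ)) ξ) 2 :=
    (Lp.memLp (𝓕 (damp β f))).of_le_mul ((by fun_prop : Continuous fun ξ : ℝ =>
      ((β : ℂ) + 2 * Real.pi * ξ * Complex.I) - β).aestronglyMeasurable.mul (Lp.memLp _).1) hb
  obtain ⟨g, hg⟩ : ∃ g, (f, g) ∈ fnGraph β (fun z => z - β) := exists_mem_fnGraph hz
  have hgr : (f, g + (β : ℂ) • f) ∈ fnGraph β fun z => z :=
    fnGraph_congr (fnGraph_add hg (fnGraph_smul β (fnGraph_one f))) (by intros; ring)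
  refine ⟨f, g + (β : ℂ) • f, mem_graph_grad hgr, ?_, ?_⟩
  · rintro rfl
    rw [map_zero, FourierTransform.fourier_zero] at hf
    have h0 : (volume : Measure ℝ) (Set.Icc 0 δ) = 0 := by
      refine measure_mono_null (fun ξ hξ => ?_)
        (ae_iff.1 (hf.symm.trans (Lp.coeFn_zero ℂ 2 volume)))
      simpa using hξ
    rw [Real.volume_Icc, sub_zero, ENNReal.ofReal_eq_zero] at h0
    exact hδ0.not_ge h0
  · rw [add_sub_cancel_right, ← norm_damp g, ← norm_damp f, ← Lp.norm_fourier_eq (damp β g),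
      ← Lp.norm_fourier_eq (damp β f)]
    refine Lp.norm_le_mul_norm_of_ae_le_mul ?_
    rw [mem_fnGraph_iff] at hg
    filter_upwards [hb, hg] with ξ hξ hgξ
    rwa [hgξ]

/-- The approximate eigenvectors of `∇` at `β` put `ν + β` into the spectrum of `ν + ∇`. -/
theorem pos_of_rePos_scalarOp_add_grad {β ν : ℝ} (h : RePos (scalarOp β ν + grad β)) :
    0 < ν + β := by
  have := h (ν + β : ℝ) <| mem_opSpectrum_of_approximate_eigenvectors fun ε hε => by
    obtain ⟨f, g, hg, hf0, hle⟩ := exists_approximate_eigenvector_grad β hε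
    refine ⟨f, _, mem_graph_add (mem_graph_scalarOp ν f) hg, hf0, ?_⟩
    have e : ((ν + β : ℝ) : ℂ) • f - ((ν : ℂ) • f + g) = -(g - (β : ℂ) • f) := by
      push_cast
      module
    rwa [e, norm_neg]
  simpa using this

theorem pos_of_rePos_scalarOp_sub_grad {β ν : ℝ} (h : RePos (scalarOp β ν - grad β)) :
    0 < ν - β := by
  have := h (ν - β : ℝ) <| mem_opSpectrum_of_approximate_eigenvectors fun ε hε => by
    obtain ⟨f, g, hg, hf0, hle⟩ := exists_approximate_eigenvector_grad β hε
    refine ⟨f, _, mem_graph_sub (mem_graph_scalarOp ν f) hg, hf0, ?_⟩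
    have e : ((ν - β : ℝ) : ℂ) • f - ((ν : ℂ) • f - g) = g - (β : ℂ) • f := by
      push_cast
      module
    rwa [e]
  simpa using this

/-! ### Second order remainders -/

theorem integral_one_sub_mul_deriv_deriv {G G' G'' : ℝ → ℂ}
    (hG : ∀ t ∈ Set.Icc (0 : ℝ) 1, HasDerivAt G (G' t) t)
    (hG' : ∀ t ∈ Set.Icc (0 : ℝ) 1, HasDerivAt G' (G'' t) t)
    (hc : ContinuousOn G'' (Set.Icc 0 1)) :
    ∫ t in (0 : ℝ)..1, (1 - t : ℝ) * G'' t = G 1 - G 0 - G' 0 := by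
  have hu : Set.uIcc (0 : ℝ) 1 = Set.Icc 0 1 := Set.uIcc_of_le zero_le_one
  have hd : ∀ t ∈ Set.uIcc (0 : ℝ) 1,
      HasDerivAt (fun t => ((1 - t : ℝ) : ℂ) * G' t + G t) ((1 - t : ℝ) * G'' t) t := by
    intro t ht
    rw [hu] at ht
    have h1 : HasDerivAt (fun t : ℝ => ((1 - t : ℝ) : ℂ)) (-1) t := by
      simpa using ((hasDerivAt_id t).const_sub 1).ofReal_comp
    exact ((h1.mul (hG' t ht)).add (hG t ht)).congr_deriv (by ring)
  rw [intervalIntegral.integral_eq_sub_of_hasDerivAt hd]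
  · simp
    ring
  · refine ContinuousOn.intervalIntegrable ?_
    rw [hu]
    exact (by fun_prop : Continuous fun t : ℝ => ((1 - t : ℝ) : ℂ)).continuousOn.mul hc

theorem exp_mul_le_one_add_exp {t : ℝ} (ht : t ∈ Set.Icc (0 : ℝ) 1) (a : ℝ) :
    Real.exp (t * a) ≤ 1 + Real.exp a := by
  rcases le_total 0 a with h | h
  · have : Real.exp (t * a) ≤ Real.exp a := Real.exp_le_exp.2 (by nlinarith [ht.2])
    linarith
  · have : Real.exp (t * a) ≤ 1 :=
      Real.exp_le_one_iff.2 (mul_nonpos_of_nonneg_of_nonpos ht.1 h)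
    linarith [Real.exp_pos a]

theorem hasDerivAt_cexp_ofReal_mul (w : ℂ) (t : ℝ) :
    HasDerivAt (fun t : ℝ => Complex.exp (t * w)) (w * Complex.exp (t * w)) t := by
  have h := (((hasDerivAt_id t).ofReal_comp).mul_const w).cexp
  simpa [mul_comm] using h

theorem integral_one_sub_mul_cexp (w : ℂ) :
    ∫ t in (0 : ℝ)..1, (1 - t : ℝ) * (w ^ 2 * Complex.exp (t * w)) = Complex.exp w - 1 - w := by
  have h := integral_one_sub_mul_deriv_deriv (G := fun t => Complex.exp (t * w))
    (G' := fun t => w * Complex.exp (t * w)) (G'' := fun t => w ^ 2 * Complex.exp (t * w))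
    (fun t _ => hasDerivAt_cexp_ofReal_mul w t)
    (fun t _ => ((hasDerivAt_cexp_ofReal_mul w t).const_mul w).congr_deriv (by ring)) (by fun_prop)
  simpa using h

theorem norm_cexp_sub_one_le (w : ℂ) :
    ‖Complex.exp w - 1‖ ≤ ‖w‖ * (1 + Real.exp w.re) := by
  have h : ∫ t in (0 : ℝ)..1, w * Complex.exp (t * w) = Complex.exp w - 1 := by
    rw [intervalIntegral.integral_eq_sub_of_hasDerivAt
      (fun t _ => hasDerivAt_cexp_ofReal_mul w t)
      ((by fun_prop : Continuous fun t : ℝ => w * Complex.exp (t * w)).intervalIntegrable _ _)]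
    simp
  rw [← h]
  refine (intervalIntegral.norm_integral_le_of_norm_le_const (C := ‖w‖ * (1 + Real.exp w.re))
    fun t ht => ?_).trans_eq (by simp)
  rw [Set.uIoc_of_le zero_le_one] at ht
  rw [norm_mul, Complex.norm_exp, Complex.re_ofReal_mul]
  exact mul_le_mul_of_nonneg_left (exp_mul_le_one_add_exp ⟨ht.1.le, ht.2⟩ _) (norm_nonneg _)

theorem norm_cexp_sub_one_sub_le_sq (w : ℂ) :
    ‖Complex.exp w - 1 - w‖ ≤ ‖w‖ ^ 2 * (1 + Real.exp w.re) := by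
  rw [← integral_one_sub_mul_cexp]
  refine (intervalIntegral.norm_integral_le_of_norm_le_const (C := ‖w‖ ^ 2 * (1 + Real.exp w.re))
    fun t ht => ?_).trans_eq (by simp)
  rw [Set.uIoc_of_le zero_le_one] at ht
  rw [norm_mul, norm_mul, norm_pow, Complex.norm_exp, Complex.re_ofReal_mul, Complex.norm_real,
    Real.norm_of_nonneg (by linarith [ht.2])]
  calc (1 - t) * (‖w‖ ^ 2 * Real.exp (t * w.re)) ≤ 1 * (‖w‖ ^ 2 * Real.exp (t * w.re)) := by
        gcongr
        linarith [ht.1]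
    _ ≤ _ := by
        rw [one_mul]
        exact mul_le_mul_of_nonneg_left (exp_mul_le_one_add_exp ⟨ht.1.le, ht.2⟩ _) (by positivity)

/-- Interpolation between the quadratic bound for `‖w‖ ≤ 1` and the linear one for `‖w‖ ≥ 1`. An
order `σ` below `2` is needed because `f` may have fewer than two derivatives. -/
theorem norm_cexp_sub_one_sub_le_rpow (w : ℂ) {σ : ℝ} (h1 : 1 ≤ σ) (h2 : σ ≤ 2) :
    ‖Complex.exp w - 1 - w‖ ≤ 2 * ‖w‖ ^ σ * (1 + Real.exp w.re) := by
  have he := Real.exp_pos w.re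
  rcases le_total ‖w‖ 1 with h | h
  · rcases eq_or_ne w 0 with rfl | hw
    · simp [Real.zero_rpow (by linarith : σ ≠ 0)]
    have hp : ‖w‖ ^ 2 ≤ ‖w‖ ^ σ := by
      rw [← Real.rpow_natCast]
      exact Real.rpow_le_rpow_of_exponent_ge (norm_pos_iff.2 hw) h (by simpa using h2)
    have h0 : 0 ≤ ‖w‖ ^ σ := by positivity
    calc _ ≤ ‖w‖ ^ 2 * (1 + Real.exp w.re) := norm_cexp_sub_one_sub_le_sq w
      _ ≤ _ := by gcongr; linarith
  · have hp : ‖w‖ ≤ ‖w‖ ^ σ := Real.self_le_rpow_of_one_le h h1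
    have h3 : ‖Complex.exp w - 1 - w‖ ≤ ‖w‖ * (1 + Real.exp w.re) + ‖w‖ :=
      (norm_sub_le _ _).trans (by gcongr; exact norm_cexp_sub_one_le w)
    have h4 : ‖w‖ * Real.exp w.re ≤ ‖w‖ ^ σ * Real.exp w.re := by gcongr
    have h5 : 0 ≤ ‖w‖ ^ σ * Real.exp w.re := by positivity
    nlinarith

/-! ### Gamma integrals -/

theorem integrableOn_rpow_mul_exp_neg_mul {p r : ℝ} (hp : -1 < p) (hr : 0 < r) :
    IntegrableOn (fun y : ℝ => y ^ p * Real.exp (-(r * y))) (Set.Ioi 0) := by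
  simpa [neg_mul] using integrableOn_rpow_mul_exp_neg_mul_rpow hp one_pos hr

/-- The case of real `r` extends by the identity theorem. In `z = -r` the left side is the complex
moment generating function of the density `y^{a-1}`, hence analytic on `Re z < 0`. -/
theorem integral_rpow_mul_cexp_neg_mul_Ioi {a : ℝ} (ha : 0 < a) {r : ℂ} (hr : 0 < r.re) :
    ∫ y in Set.Ioi (0 : ℝ), ((y ^ (a - 1) : ℝ) : ℂ) * Complex.exp (-(r * y)) =
      Real.Gamma a * r ^ (-(a : ℂ)) := by
  set μ : Measure ℝ := (volume.restrict (Set.Ioi (0 : ℝ))).withDensity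
    fun y => ENNReal.ofReal (y ^ (a - 1)) with hμ
  have hm : Measurable fun y : ℝ => ENNReal.ofReal (y ^ (a - 1)) := by fun_prop
  have hlt : ∀ᵐ y : ℝ ∂volume.restrict (Set.Ioi (0 : ℝ)), ENNReal.ofReal (y ^ (a - 1)) < ⊤ :=
    Filter.Eventually.of_forall fun _ => ENNReal.ofReal_lt_top
  have hM : ∀ z : ℂ, ProbabilityTheory.complexMGF id μ z =
      ∫ y in Set.Ioi (0 : ℝ), ((y ^ (a - 1) : ℝ) : ℂ) * Complex.exp (z * y) := by
    intro z
    rw [ProbabilityTheory.complexMGF, hμ, integral_withDensity_eq_integral_toReal_smul hm hlt]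
    refine setIntegral_congr_fun measurableSet_Ioi fun y hy => ?_
    simp only [id, ENNReal.toReal_ofReal (Real.rpow_nonneg (le_of_lt hy) _), Complex.real_smul]
  have hset : Set.Iio 0 ⊆ ProbabilityTheory.integrableExpSet id μ := by
    intro t ht
    change Integrable _ μ
    rw [hμ, integrable_withDensity_iff_integrable_smul' hm hlt]
    refine IntegrableOn.congr_fun (integrableOn_rpow_mul_exp_neg_mul (p := a - 1) (r := -t)
      (by linarith) (by simpa using ht)) (fun y hy => ?_) measurableSet_Ioi
    simp [ENNReal.toReal_ofReal (Real.rpow_nonneg (le_of_lt hy) _)]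
  have hU : {z : ℂ | z.re < 0} ⊆
      {z : ℂ | z.re ∈ interior (ProbabilityTheory.integrableExpSet id μ)} :=
    fun z hz => interior_maximal hset isOpen_Iio hz
  have hA : AnalyticOnNhd ℂ (ProbabilityTheory.complexMGF id μ) {z : ℂ | z.re < 0} :=
    ProbabilityTheory.analyticOnNhd_complexMGF.mono hU
  have hB : AnalyticOnNhd ℂ (fun z : ℂ => (Real.Gamma a : ℂ) * (-z) ^ (-(a : ℂ)))
      {z : ℂ | z.re < 0} := by
    refine DifferentiableOn.analyticOnNhd ?_ (isOpen_lt Complex.continuous_re continuous_const)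
    intro z hz
    refine DifferentiableAt.differentiableWithinAt ?_
    have hz' : (-z) ∈ Complex.slitPlane := Or.inl (by simpa using hz)
    exact (differentiableAt_id.neg.cpow_const hz').const_mul _
  have hreal : ∀ x : ℝ, 0 < x → ProbabilityTheory.complexMGF id μ ((-x : ℝ) : ℂ) =
      (Real.Gamma a : ℂ) * (-((-x : ℝ) : ℂ)) ^ (-(a : ℂ)) := by
    intro x hx
    have h1 := Real.integral_rpow_mul_exp_neg_mul_Ioi ha hx
    rw [hM]
    have h2 : ∫ y in Set.Ioi (0 : ℝ), ((y ^ (a - 1) : ℝ) : ℂ) * Complex.exp (((-x : ℝ) : ℂ) * y) =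
        ((∫ y in Set.Ioi (0 : ℝ), y ^ (a - 1) * Real.exp (-(x * y)) : ℝ) : ℂ) := by
      rw [← integral_complex_ofReal]
      refine integral_congr_ae (Filter.Eventually.of_forall fun y => ?_)
      push_cast
      simp
    rw [h2, h1, one_div, Real.inv_rpow hx.le, ← Real.rpow_neg hx.le]
    push_cast
    rw [neg_neg, Complex.ofReal_cpow hx.le]
    push_cast
    ring
  -- The points `-x` with `x` decreasing to `1` accumulate at `-1` without meeting it.
  have hfreq : ∃ᶠ z in nhdsWithin (-1 : ℂ) {-1}ᶜ, ProbabilityTheory.complexMGF id μ z =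
      (Real.Gamma a : ℂ) * (-z) ^ (-(a : ℂ)) := by
    have ht : Filter.Tendsto (fun x : ℝ => ((-x : ℝ) : ℂ)) (nhdsWithin 1 (Set.Ioi 1))
        (nhdsWithin (-1 : ℂ) {-1}ᶜ) := by
      refine tendsto_nhdsWithin_iff.2 ⟨?_, ?_⟩
      · have : Continuous fun x : ℝ => ((-x : ℝ) : ℂ) := by fun_prop
        have h := this.tendsto 1
        simp only [Complex.ofReal_neg, Complex.ofReal_one] at h
        refine Filter.Tendsto.mono_left ?_ nhdsWithin_le_nhds
        simpa using h
      · filter_upwards [self_mem_nhdsWithin] with x hx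
        have h1 : x ≠ 1 := ne_of_gt hx
        simpa [neg_inj] using (by exact_mod_cast h1 : (x : ℂ) ≠ 1)
    refine ht.frequently (Filter.Eventually.frequently ?_)
    filter_upwards [self_mem_nhdsWithin] with x hx
    exact hreal x (lt_trans one_pos hx)
  have hconn : IsPreconnected {z : ℂ | z.re < 0} :=
    (convex_halfSpace_re_lt 0).isPreconnected
  have h := hA.eqOn_of_preconnected_of_frequently_eq hB hconn (z₀ := -1) (by simp) hfreq
    (show (-r) ∈ {z : ℂ | z.re < 0} by simpa using hr)
  rw [hM] at h
  simpa using h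

/-! ### The symbol of a one-sided tempered stable jump operator -/

/-- The density `e^{-νy} / y^{1+α}` on the positive half-line. -/
def tsDensity (ν α y : ℝ) : ℝ := Real.exp (-(ν * y)) / y ^ (1 + α)

theorem measurable_tsDensity (ν α : ℝ) : Measurable (tsDensity ν α) := by
  unfold tsDensity
  fun_prop

theorem tsDensity_nonneg (ν α : ℝ) {y : ℝ} (hy : 0 < y) : 0 ≤ tsDensity ν α y := by
  unfold tsDensity
  positivity

theorem rpow_mul_tsDensity (ν α σ : ℝ) {y : ℝ} (hy : 0 < y) :
    y ^ σ * tsDensity ν α y = y ^ (σ - (1 + α)) * Real.exp (-(ν * y)) := by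
  rw [tsDensity, Real.rpow_sub hy]
  ring

theorem integrableOn_rpow_mul_exp_mul_tsDensity {ν α σ a : ℝ} (hσ : α < σ) (ha : a < ν) :
    IntegrableOn (fun y => y ^ σ * Real.exp (a * y) * tsDensity ν α y) (Set.Ioi 0) := by
  refine (integrableOn_rpow_mul_exp_neg_mul (p := σ - (1 + α)) (r := ν - a) (by linarith)
    (by linarith)).congr_fun (fun y hy => ?_) measurableSet_Ioi
  rw [mul_right_comm, rpow_mul_tsDensity ν α σ hy, mul_assoc, ← Real.exp_add]
  ring_nf

theorem integrableOn_rpow_mul_tsDensity {ν α σ : ℝ} (hσ : α < σ) (hν : 0 < ν) :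
    IntegrableOn (fun y => y ^ σ * tsDensity ν α y) (Set.Ioi 0) := by
  simpa using integrableOn_rpow_mul_exp_mul_tsDensity hσ hν

theorem integrableOn_cexp_sub_mul_tsDensity {ν α : ℝ} (hν : 0 < ν) (hα : α < 2) {w : ℂ}
    (hw : w.re < ν) :
    IntegrableOn (fun y : ℝ => (Complex.exp (w * y) - 1 - w * y) * (tsDensity ν α y : ℂ))
      (Set.Ioi 0) := by
  have hb := ((integrableOn_rpow_mul_tsDensity hα hν).add
    (integrableOn_rpow_mul_exp_mul_tsDensity hα hw)).const_mul (‖w‖ ^ 2)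
  refine hb.mono' ?_ ?_
  · have := measurable_tsDensity ν α
    exact Measurable.aestronglyMeasurable (by fun_prop)
  · filter_upwards [ae_restrict_mem measurableSet_Ioi] with y hy
    have hy0 : (0 : ℝ) < y := hy
    rw [norm_mul, Complex.norm_real, Real.norm_of_nonneg (tsDensity_nonneg ν α hy0)]
    have h1 := norm_cexp_sub_one_sub_le_sq (w * y)
    rw [norm_mul, Complex.norm_real, Real.norm_of_nonneg hy0.le, Complex.re_mul_ofReal] at h1
    calc _ ≤ (‖w‖ * y) ^ 2 * (1 + Real.exp (w.re * y)) * tsDensity ν α y :=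
          mul_le_mul_of_nonneg_right h1 (tsDensity_nonneg ν α hy0)
      _ = _ := by
          simp only [Pi.add_apply, Real.rpow_two]
          ring

/-- Taylor's formula is used twice: for `e^{wy}` under the integral, and backwards for `F` along the
segment from `0` to `w`. Fubini and the Gamma integral identify the two remainders. -/
theorem integral_cexp_sub_mul_tsDensity {ν α : ℝ} (hν : 0 < ν) (hα : α < 2) {F F' : ℂ → ℂ}
    (hF : ∀ z : ℂ, z.re < ν → HasDerivAt F (F' z) z)
    (hF' : ∀ z : ℂ, z.re < ν →
      HasDerivAt F' (Real.Gamma (2 - α) * (ν - z) ^ ((α : ℂ) - 2)) z)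
    {w : ℂ} (hw : w.re < ν) :
    ∫ y in Set.Ioi (0 : ℝ), (Complex.exp (w * y) - 1 - w * y) * (tsDensity ν α y : ℂ) =
      F w - F 0 - F' 0 * w := by
  set H : ℝ → ℝ → ℂ := fun y t =>
    (1 - t : ℝ) * (w ^ 2 * (((y ^ (1 - α) : ℝ) : ℂ) * Complex.exp (-((ν - t * w) * y)))) with hH
  -- The segment from `0` to `w` stays in the half-plane `Re < ν`, since both endpoints lie in it.
  have hre : ∀ t ∈ Set.Icc (0 : ℝ) 1, ((t : ℂ) * w).re < ν := by
    intro t ht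
    rw [Complex.re_ofReal_mul]
    rcases le_total 0 w.re with h | h
    · exact lt_of_le_of_lt (by nlinarith [ht.2]) hw
    · exact lt_of_le_of_lt (mul_nonpos_of_nonneg_of_nonpos ht.1 h) hν
  have h1 : ∀ y ∈ Set.Ioi (0 : ℝ),
      (Complex.exp (w * y) - 1 - w * y) * (tsDensity ν α y : ℂ) =
        ∫ t in Set.Ioc (0 : ℝ) 1, H y t := by
    intro y hy
    rw [← intervalIntegral.integral_of_le zero_le_one, ← integral_one_sub_mul_cexp,
      ← intervalIntegral.integral_mul_const]
    refine intervalIntegral.integral_congr fun t _ => ?_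
    have h2 : ((y : ℂ) ^ 2) * (tsDensity ν α y : ℂ) =
        ((y ^ (1 - α) : ℝ) : ℂ) * Complex.exp (-(ν * y)) := by
      have := rpow_mul_tsDensity ν α 2 hy
      rw [Real.rpow_two, show (2 : ℝ) - (1 + α) = 1 - α by ring] at this
      exact_mod_cast congrArg Complex.ofReal this
    have h3 : Complex.exp (-((ν - t * w) * y)) =
        Complex.exp (-(ν * y)) * Complex.exp (t * (w * y)) := by
      rw [← Complex.exp_add]
      ring_nf
    simp only [hH, h3]
    linear_combination ((1 - t : ℝ) : ℂ) * w ^ 2 * Complex.exp (t * (w * y)) * h2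
  have hint : Integrable (Function.uncurry H) ((volume.restrict (Set.Ioi (0 : ℝ))).prod
      (volume.restrict (Set.Ioc (0 : ℝ) 1))) := by
    -- Bounding `e^{t a}` by `1 + e^a` gives a majorant independent of `t`.
    have hb := (((integrableOn_rpow_mul_exp_neg_mul (p := 1 - α) (by linarith) hν).add
      (integrableOn_rpow_mul_exp_neg_mul (p := 1 - α) (r := ν - w.re) (by linarith)
        (by linarith))).const_mul (‖w‖ ^ 2)).comp_fst (volume.restrict (Set.Ioc (0 : ℝ) 1))
    refine hb.mono' ?_ ?_
    · refine Measurable.aestronglyMeasurable ?_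
      simp only [hH, Function.uncurry_def]
      fun_prop
    · rw [Measure.prod_restrict]
      filter_upwards [ae_restrict_mem (measurableSet_Ioi.prod measurableSet_Ioc)]
        with ⟨y, t⟩ ⟨hy, ht⟩
      have hy0 : (0 : ℝ) < y := hy
      have ht1 : t ∈ Set.Icc (0 : ℝ) 1 := ⟨ht.1.le, ht.2⟩
      have hre1 : (-((ν - t * w) * y)).re = -(ν * y) + t * (w.re * y) := by
        simp [Complex.sub_re]
        ring
      simp only [hH, Function.uncurry_apply_pair, norm_mul, norm_pow, Complex.norm_real,
        Complex.norm_exp, hre1, Real.exp_add,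
        Real.norm_of_nonneg (Real.rpow_nonneg hy0.le (1 - α)),
        Real.norm_of_nonneg (sub_nonneg.2 ht1.2), Pi.add_apply]
      have h2 := exp_mul_le_one_add_exp ht1 (w.re * y)
      have h3 : Real.exp (-((ν - w.re) * y)) = Real.exp (-(ν * y)) * Real.exp (w.re * y) := by
        rw [← Real.exp_add]
        ring_nf
      rw [h3]
      have h4 : 0 ≤ ‖w‖ ^ 2 * (y ^ (1 - α) * Real.exp (-(ν * y))) := by positivity
      calc _ = (1 - t) * (‖w‖ ^ 2 * (y ^ (1 - α) * Real.exp (-(ν * y)))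
            * Real.exp (t * (w.re * y))) := by ring
        _ ≤ 1 * (‖w‖ ^ 2 * (y ^ (1 - α) * Real.exp (-(ν * y)))
            * (1 + Real.exp (w.re * y))) := by
          gcongr
          linarith [ht1.1]
        _ = _ := by ring
  rw [setIntegral_congr_fun measurableSet_Ioi h1, integral_integral_swap hint,
    ← intervalIntegral.integral_of_le zero_le_one]
  have h5 : ∀ t ∈ Set.uIcc (0 : ℝ) 1, ∫ y in Set.Ioi (0 : ℝ), H y t =
      (1 - t : ℝ) * (w ^ 2 * (Real.Gamma (2 - α) * (ν - t * w) ^ ((α : ℂ) - 2))) := by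
    intro t ht
    rw [Set.uIcc_of_le zero_le_one] at ht
    have h6 := integral_rpow_mul_cexp_neg_mul_Ioi (a := 2 - α) (by linarith) (r := ν - t * w)
      (by have := hre t ht; rw [Complex.sub_re, Complex.ofReal_re]; linarith)
    rw [show (2 : ℝ) - α - 1 = 1 - α by ring,
      show -(((2 - α : ℝ)) : ℂ) = (α : ℂ) - 2 by push_cast; ring] at h6
    simp only [hH]
    rw [integral_const_mul, integral_const_mul, h6]
  rw [intervalIntegral.integral_congr h5]
  have hlin : ∀ t : ℝ, HasDerivAt (fun t : ℝ => (t : ℂ) * w) w t := fun t => by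
    simpa using ((hasDerivAt_id t).ofReal_comp).mul_const w
  rw [integral_one_sub_mul_deriv_deriv (G := fun t => F (t * w)) (G' := fun t => w * F' (t * w))]
  · simp
    ring
  · intro t ht
    exact ((hF _ (hre t ht)).comp t (hlin t)).congr_deriv (by ring)
  · intro t ht
    exact (((hF' _ (hre t ht)).comp t (hlin t)).const_mul w).congr_deriv (by ring)
  · intro t ht
    refine ContinuousAt.continuousWithinAt ?_
    refine continuousAt_const.mul (continuousAt_const.mul (ContinuousAt.cpow ?_ ?_ ?_))
    · fun_prop
    · fun_prop
    · have := hre t ht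
      exact Or.inl (by rw [Complex.sub_re, Complex.ofReal_re]; linarith)

/-- The integrand is a combination of the Taylor remainders at `w` and at `c`, with the terms linear
in `y` cancelling; so `F' 0` drops out. The value `c = 1` serves positive jumps, `c = -1` reflected
negative ones. -/
theorem integral_compensated_mul_tsDensity {ν α : ℝ} (hν : 0 < ν) (hα : α < 2) {F F' : ℂ → ℂ}
    (hF : ∀ z : ℂ, z.re < ν → HasDerivAt F (F' z) z)
    (hF' : ∀ z : ℂ, z.re < ν →
      HasDerivAt F' (Real.Gamma (2 - α) * (ν - z) ^ ((α : ℂ) - 2)) z)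
    {c : ℝ} (hc0 : c ≠ 0) (hc : c < ν) {w : ℂ} (hw : w.re < ν) :
    ∫ y in Set.Ioi (0 : ℝ), (Complex.exp (w * y) - 1 - w / c * (Complex.exp (c * y) - 1))
        * (tsDensity ν α y : ℂ) = F w - F 0 - w / c * (F c - F 0) := by
  have hc' : (c : ℂ) ≠ 0 := by exact_mod_cast hc0
  have hcν : (c : ℂ).re < ν := by simpa using hc
  have e : ∀ y : ℝ, (Complex.exp (w * y) - 1 - w / c * (Complex.exp (c * y) - 1))
        * (tsDensity ν α y : ℂ) = (Complex.exp (w * y) - 1 - w * y) * (tsDensity ν α y : ℂ)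
        - w / c * ((Complex.exp (c * y) - 1 - c * y) * (tsDensity ν α y : ℂ)) := by
    intro y
    field_simp
    ring
  simp only [e]
  rw [integral_sub (integrableOn_cexp_sub_mul_tsDensity hν hα hw)
    ((integrableOn_cexp_sub_mul_tsDensity hν hα hcν).const_mul _), integral_const_mul,
    integral_cexp_sub_mul_tsDensity hν hα hF hF' hw,
    integral_cexp_sub_mul_tsDensity hν hα hF hF' hcν]
  field_simp
  ring

section Symbol

variable {ν α : ℝ} {z : ℂ}

theorem sub_mem_slitPlane (hz : z.re < ν) : (ν : ℂ) - z ∈ Complex.slitPlane :=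
  Or.inl (by rw [Complex.sub_re, Complex.ofReal_re]; linarith)

theorem hasDerivAt_sub_cpow (hz : z.re < ν) (a : ℂ) :
    HasDerivAt (fun z : ℂ => ((ν : ℂ) - z) ^ a) (-(a * ((ν : ℂ) - z) ^ (a - 1))) z := by
  have h := ((hasDerivAt_id z).const_sub (ν : ℂ)).cpow_const (c := a) (sub_mem_slitPlane hz)
  exact h.congr_deriv (by simp)

theorem hasDerivAt_log_sub (hz : z.re < ν) :
    HasDerivAt (fun z : ℂ => Complex.log ((ν : ℂ) - z)) (-((ν : ℂ) - z)⁻¹) z := by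
  have h := ((hasDerivAt_id z).const_sub (ν : ℂ)).clog (sub_mem_slitPlane hz)
  exact h.congr_deriv (by simp [neg_div])

theorem integral_compensated_mul_tsDensity_of_ne (hν : 0 < ν) (hα : α < 2) (h0 : α ≠ 0)
    (h1 : α ≠ 1) {c : ℝ} (hc0 : c ≠ 0) (hc : c < ν) {w : ℂ} (hw : w.re < ν) :
    ∫ y in Set.Ioi (0 : ℝ), (Complex.exp (w * y) - 1 - w / c * (Complex.exp (c * y) - 1))
        * (tsDensity ν α y : ℂ) = Real.Gamma (-α) * ((ν - w) ^ (α : ℂ) - (ν ^ α : ℝ)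
          - w / c * (((ν - c) ^ α : ℝ) - (ν ^ α : ℝ))) := by
  -- This is why `α = 0` and `α = 1` need other antiderivatives: the recursion for `Γ` breaks down
  -- there.
  have hG : Real.Gamma (2 - α) = (1 - α) * (-α) * Real.Gamma (-α) := by
    rw [show (2 : ℝ) - α = (1 - α) + 1 by ring, Real.Gamma_add_one (sub_ne_zero.2 h1.symm),
      show (1 : ℝ) - α = -α + 1 by ring, Real.Gamma_add_one (neg_ne_zero.2 h0)]
    ring
  rw [integral_compensated_mul_tsDensity hν hα
    (F := fun z => Real.Gamma (-α) * ((ν : ℂ) - z) ^ (α : ℂ))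
    (F' := fun z => Real.Gamma (-α) * (-(α * ((ν : ℂ) - z) ^ ((α : ℂ) - 1)))) ?_ ?_ hc0 hc hw]
  · rw [Complex.ofReal_cpow hν.le, Complex.ofReal_cpow (by linarith : 0 ≤ ν - c)]
    push_cast
    rw [sub_zero]
    ring
  · exact fun z hz => (hasDerivAt_sub_cpow hz _).const_mul _
  · intro z hz
    refine ((((hasDerivAt_sub_cpow hz ((α : ℂ) - 1)).const_mul (α : ℂ)).neg).const_mul
      (Real.Gamma (-α) : ℂ)).congr_deriv ?_
    rw [hG, show (α : ℂ) - 1 - 1 = α - 2 by ring]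
    push_cast
    ring

theorem integral_compensated_mul_tsDensity_zero (hν : 0 < ν) {c : ℝ} (hc0 : c ≠ 0) (hc : c < ν)
    {w : ℂ} (hw : w.re < ν) :
    ∫ y in Set.Ioi (0 : ℝ), (Complex.exp (w * y) - 1 - w / c * (Complex.exp (c * y) - 1))
        * (tsDensity ν 0 y : ℂ) = Real.log ν - Complex.log (ν - w)
          + w / c * Real.log ((ν - c) / ν) := by
  have hc' : 0 < ν - c := by linarith
  rw [integral_compensated_mul_tsDensity hν two_pos
    (F := fun z => -Complex.log ((ν : ℂ) - z)) (F' := fun z => ((ν : ℂ) - z)⁻¹) ?_ ?_ hc0 hc hw]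
  · rw [Real.log_div hc'.ne' hν.ne', sub_zero, Complex.ofReal_sub, Complex.ofReal_log hν.le,
      Complex.ofReal_log hc'.le]
    push_cast
    ring
  · exact fun z hz => (hasDerivAt_log_sub hz).neg.congr_deriv (neg_neg _)
  · intro z hz
    have hne := Complex.slitPlane_ne_zero (sub_mem_slitPlane hz)
    refine (((hasDerivAt_id z).const_sub (ν : ℂ)).inv hne).congr_deriv ?_
    rw [sub_zero, Real.Gamma_two, show (((0 : ℝ) : ℂ) - 2) = -(2 : ℕ) by simp,
      Complex.cpow_neg, Complex.cpow_natCast]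
    simp [div_eq_mul_inv]

theorem integral_compensated_mul_tsDensity_one (hν : 0 < ν) {c : ℝ} (hc0 : c ≠ 0) (hc : c < ν)
    {w : ℂ} (hw : w.re < ν) :
    ∫ y in Set.Ioi (0 : ℝ), (Complex.exp (w * y) - 1 - w / c * (Complex.exp (c * y) - 1))
        * (tsDensity ν 1 y : ℂ) = (ν - w) * Complex.log (ν - w) - (ν * Real.log ν : ℝ)
          - w / c * ((ν - c) * Real.log (ν - c) - ν * Real.log ν : ℝ) := by
  have hc' : 0 < ν - c := by linarith
  rw [integral_compensated_mul_tsDensity hν one_lt_two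
    (F := fun z => ((ν : ℂ) - z) * Complex.log ((ν : ℂ) - z))
    (F' := fun z => -Complex.log ((ν : ℂ) - z) - 1) ?_ ?_ hc0 hc hw]
  · push_cast
    rw [sub_zero, Complex.ofReal_log hν.le, Complex.ofReal_log hc'.le]
    push_cast
    ring
  · intro z hz
    have hne := Complex.slitPlane_ne_zero (sub_mem_slitPlane hz)
    refine (((hasDerivAt_id z).const_sub (ν : ℂ)).mul (hasDerivAt_log_sub hz)).congr_deriv ?_
    simp only [id]
    field_simp
    ring
  · intro z hz
    refine ((hasDerivAt_log_sub hz).neg.sub_const 1).congr_deriv ?_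
    rw [show (2 : ℝ) - 1 = 1 by norm_num, Real.Gamma_one,
      show (((1 : ℝ) : ℂ) - 2) = -1 by push_cast; norm_num, Complex.cpow_neg_one]
    simp

end Symbol

/-! ### The symbol of the compensated translation -/

/-- The symbol `e^{zy} - 1 - z (e^y - 1)` of the compensated translation by `y`. -/
def jumpSymbol (z : ℂ) (y : ℝ) : ℂ := Complex.exp (z * y) - 1 - z * (Real.exp y - 1 : ℝ)

/-- The weight `|y|^σ (4 + 2 e^{βy} + 2 e^y)`, which controls the compensated translation by `y`
on functions of order `σ`. -/
def jumpWeight (β σ y : ℝ) : ℝ := |y| ^ σ * (4 + 2 * Real.exp (β * y) + 2 * Real.exp y)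

theorem jumpWeight_nonneg (β σ y : ℝ) : 0 ≤ jumpWeight β σ y := by
  unfold jumpWeight
  positivity

/-- The terms `zy` cancel between `e^{zy} - 1 - zy` and `z(e^y - 1 - y)`, so both parts are of order
`|y|^σ` near `0`. Since `σ ≥ 1`, the factor `‖z‖` is also at most `(1 + ‖z‖)^σ`. -/
theorem norm_jumpSymbol_le {σ : ℝ} (h1 : 1 ≤ σ) (h2 : σ ≤ 2) (z : ℂ) (y : ℝ) :
    ‖jumpSymbol z y‖ ≤ jumpWeight z.re σ y * (1 + ‖z‖) ^ σ := by
  have e : jumpSymbol z y = (Complex.exp (z * y) - 1 - z * y)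
      - z * (Complex.exp (y : ℂ) - 1 - y) := by
    rw [jumpSymbol]
    push_cast
    ring
  have b1 := norm_cexp_sub_one_sub_le_rpow (z * y) h1 h2
  have b2 := norm_cexp_sub_one_sub_le_rpow (y : ℂ) h1 h2
  rw [norm_mul, Complex.norm_real, Real.norm_eq_abs, Complex.re_mul_ofReal,
    Real.mul_rpow (norm_nonneg _) (abs_nonneg _)] at b1
  rw [Complex.norm_real, Real.norm_eq_abs, Complex.ofReal_re] at b2
  have c1 : ‖z‖ ^ σ ≤ (1 + ‖z‖) ^ σ := by gcongr; linarith
  have c2 : ‖z‖ ≤ (1 + ‖z‖) ^ σ :=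
    (by linarith : ‖z‖ ≤ 1 + ‖z‖).trans
      (Real.self_le_rpow_of_one_le (by linarith [norm_nonneg z]) h1)
  rw [e, jumpWeight]
  calc _ ≤ 2 * (‖z‖ ^ σ * |y| ^ σ) * (1 + Real.exp (z.re * y))
        + ‖z‖ * (2 * |y| ^ σ * (1 + Real.exp y)) := by
        refine (norm_sub_le _ _).trans (add_le_add b1 ?_)
        rw [norm_mul]
        gcongr
    _ ≤ 2 * ((1 + ‖z‖) ^ σ * |y| ^ σ) * (1 + Real.exp (z.re * y))
        + (1 + ‖z‖) ^ σ * (2 * |y| ^ σ * (1 + Real.exp y)) := by gcongr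
    _ = _ := by ring

/-! ### The compensated translation in `L²` -/

theorem memLp_comp_add {u : ℝ → ℂ} (hu : MemLp u 2 (volume : Measure ℝ)) (y : ℝ) :
    MemLp (fun x => u (x + y)) 2 (volume : Measure ℝ) :=
  hu.comp_measurePreserving (measurePreserving_add_right volume y)

theorem fourier_toLp_comp_add {u : ℝ → ℂ} (hu : MemLp u 2 (volume : Measure ℝ)) (y : ℝ) :
    (𝓕 ((memLp_comp_add hu y).toLp _) : Lp ℂ 2 (volume : Measure ℝ)) =ᵐ[volume]
      fun ξ => Complex.exp (2 * Real.pi * ξ * Complex.I * y) *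
        (𝓕 (hu.toLp u) : Lp ℂ 2 (volume : Measure ℝ)) ξ := by
  have hw : MemLp (fun ξ : ℝ => Complex.exp (2 * Real.pi * ξ * Complex.I * y) *
      (𝓕 (hu.toLp u) : Lp ℂ 2 (volume : Measure ℝ)) ξ) 2 := by
    refine (Lp.memLp (𝓕 (hu.toLp u))).of_le ?_ (Filter.Eventually.of_forall fun ξ => ?_)
    · exact (by fun_prop : Continuous fun ξ : ℝ =>
        Complex.exp (2 * Real.pi * ξ * Complex.I * y)).aestronglyMeasurable.mul (Lp.memLp _).1
    · rw [norm_mul, Complex.norm_exp]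
      simp
  rw [fourier_eq_of_integral_schwartz_mul_eq (w := hw.toLp _) fun φ => ?_]
  · exact hw.coeFn_toLp
  have e1 : ∫ x, φ x * ((memLp_comp_add hu y).toLp _ : ℝ → ℂ) x = ∫ x, φ x * u (x + y) := by
    refine integral_congr_ae ?_
    filter_upwards [(memLp_comp_add hu y).coeFn_toLp] with x hx
    rw [hx]
  have e2 : ∫ x, φ x * u (x + y) =
      ∫ x, SchwartzMap.compSubConstCLM ℂ y φ x * (hu.toLp u : ℝ → ℂ) x := by
    rw [← integral_sub_right_eq_self _ y]
    refine integral_congr_ae ?_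
    filter_upwards [hu.coeFn_toLp] with x hx
    rw [hx, SchwartzMap.compSubConstCLM_apply, sub_add_cancel]
  rw [e1, e2, integral_schwartz_mul_eq_integral_fourierInv_mul_fourier]
  refine integral_congr_ae ?_
  filter_upwards [hw.coeFn_toLp] with ξ hξ
  rw [hξ, fourierInv_compSubConst_apply]
  ring

/-- The compensated translation by `y`, conjugated with `e^{βx}`. -/
def dampedJump (β : ℝ) (u v : ℝ → ℂ) (x y : ℝ) : ℂ :=
  Real.exp (β * y) * u (x + y) - u x - (Real.exp y - 1 : ℝ) * v x

section Jump

variable {β σ : ℝ} {u v : ℝ → ℂ} {μ : ℝ → ℝ}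

theorem memLp_dampedJump (hu : MemLp u 2 (volume : Measure ℝ)) (hv : MemLp v 2 (volume : Measure ℝ))
    (y : ℝ) : MemLp (fun x => dampedJump β u v x y) 2 (volume : Measure ℝ) :=
  (((memLp_comp_add hu y).const_mul _).sub hu).sub (hv.const_mul _)

/-- The hypothesis `huv` makes `v` the damped derivative, and `e^{βy}` combines with the translation
phase to `e^{zy}`. -/
theorem fourier_dampedJump (hu : MemLp u 2 (volume : Measure ℝ))
    (hv : MemLp v 2 (volume : Measure ℝ))
    (huv : ∀ᵐ ξ : ℝ, (𝓕 (hv.toLp v) : Lp ℂ 2 (volume : Measure ℝ)) ξ =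
      (β + 2 * Real.pi * ξ * Complex.I) * (𝓕 (hu.toLp u) : Lp ℂ 2 (volume : Measure ℝ)) ξ)
    (y : ℝ) :
    (𝓕 ((memLp_dampedJump (β := β) hu hv y).toLp _) : Lp ℂ 2 (volume : Measure ℝ)) =ᵐ[volume]
      fun ξ => jumpSymbol (β + 2 * Real.pi * ξ * Complex.I) y *
        (𝓕 (hu.toLp u) : Lp ℂ 2 (volume : Measure ℝ)) ξ := by
  have e : (memLp_dampedJump (β := β) hu hv y).toLp _ =
      (Real.exp (β * y) : ℂ) • (memLp_comp_add hu y).toLp _ + (-1 : ℂ) • hu.toLp u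
        + (-(Real.exp y - 1 : ℝ) : ℂ) • hv.toLp v := by
    rw [← MemLp.toLp_const_smul, ← MemLp.toLp_const_smul, ← MemLp.toLp_const_smul,
      ← MemLp.toLp_add, ← MemLp.toLp_add, MemLp.toLp_eq_toLp_iff]
    refine Filter.Eventually.of_forall fun x => ?_
    simp only [dampedJump, Pi.add_apply, Pi.smul_apply, smul_eq_mul]
    ring
  rw [e, FourierTransform.fourier_add, FourierTransform.fourier_add, FourierTransform.fourier_smul,
    FourierTransform.fourier_smul, FourierTransform.fourier_smul]
  set U : Lp ℂ 2 (volume : Measure ℝ) := 𝓕 (hu.toLp u)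
  set V : Lp ℂ 2 (volume : Measure ℝ) := 𝓕 (hv.toLp v)
  have ht := fourier_toLp_comp_add hu y
  set S : Lp ℂ 2 (volume : Measure ℝ) := 𝓕 ((memLp_comp_add hu y).toLp _)
  filter_upwards [ht, huv, Lp.coeFn_add ((Real.exp (β * y) : ℂ) • S + (-1 : ℂ) • U)
    ((-(Real.exp y - 1 : ℝ) : ℂ) • V), Lp.coeFn_add ((Real.exp (β * y) : ℂ) • S) ((-1 : ℂ) • U),
    Lp.coeFn_smul (Real.exp (β * y) : ℂ) S, Lp.coeFn_smul (-1 : ℂ) U,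
    Lp.coeFn_smul (-(Real.exp y - 1 : ℝ) : ℂ) V] with ξ h1 h2 h3 h4 h5 h6 h7
  rw [h3, Pi.add_apply, h4, Pi.add_apply, h5, h6, h7]
  simp only [Pi.smul_apply, smul_eq_mul]
  rw [h1, h2, jumpSymbol, add_mul (β : ℂ) _ (y : ℂ), Complex.exp_add]
  push_cast
  ring

theorem toReal_eLpNorm_dampedJump_le (h1 : 1 ≤ σ) (h2 : σ ≤ 2)
    (hu : MemLp u 2 (volume : Measure ℝ)) (hv : MemLp v 2 (volume : Measure ℝ))
    (huv : ∀ᵐ ξ : ℝ, (𝓕 (hv.toLp v) : Lp ℂ 2 (volume : Measure ℝ)) ξ =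
      (β + 2 * Real.pi * ξ * Complex.I) * (𝓕 (hu.toLp u) : Lp ℂ 2 (volume : Measure ℝ)) ξ)
    (hW : MemLp (fun ξ : ℝ => ((1 + ‖(β + 2 * Real.pi * ξ * Complex.I : ℂ)‖) ^ σ : ℝ) *
      (𝓕 (hu.toLp u) : Lp ℂ 2 (volume : Measure ℝ)) ξ) 2) (y : ℝ) :
    (eLpNorm (fun x => dampedJump β u v x y) 2 volume).toReal ≤
      jumpWeight β σ y * ‖hW.toLp _‖ := by
  rw [← Lp.norm_toLp _ (memLp_dampedJump hu hv y), ← Lp.norm_fourier_eq]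
  refine Lp.norm_le_mul_norm_of_ae_le_mul ?_
  filter_upwards [fourier_dampedJump hu hv huv y, hW.coeFn_toLp] with ξ e1 e2
  rw [e1, e2, norm_mul, norm_mul, ← mul_assoc, Complex.norm_real,
    Real.norm_of_nonneg (by positivity)]
  gcongr
  simpa using norm_jumpSymbol_le h1 h2 (β + 2 * Real.pi * ξ * Complex.I) y

theorem integral_norm_mul_le {φ g : ℝ → ℂ} (hφ : MemLp φ 2 (volume : Measure ℝ))
    (hg : MemLp g 2 (volume : Measure ℝ)) :
    ∫ x, ‖φ x * g x‖ ≤ (eLpNorm φ 2 volume).toReal * (eLpNorm g 2 volume).toReal := by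
  have h := eLpNorm_smul_le_mul_eLpNorm (p := 2) (q := 2) (r := 1) hg.1 hφ.1
  rw [eLpNorm_one_eq_lintegral_enorm] at h
  have hm : AEStronglyMeasurable (fun x => φ x * g x) volume := hφ.1.mul hg.1
  rw [integral_norm_eq_lintegral_enorm hm, ← ENNReal.toReal_mul]
  exact ENNReal.toReal_mono (ENNReal.mul_ne_top hφ.2.ne hg.2.ne) h

theorem aestronglyMeasurable_dampedJump (hu : AEStronglyMeasurable u (volume : Measure ℝ))
    (hv : AEStronglyMeasurable v (volume : Measure ℝ)) :
    AEStronglyMeasurable (fun p : ℝ × ℝ => dampedJump β u v p.1 p.2)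
      ((volume : Measure ℝ).prod volume) := by
  -- As `u` is only almost everywhere strongly measurable, null sets must pull back to null sets
  -- under addition.
  have hadd : Measure.QuasiMeasurePreserving (fun p : ℝ × ℝ => p.1 + p.2)
      ((volume : Measure ℝ).prod volume) volume :=
    Measure.quasiMeasurePreserving_snd.comp
      (measurePreserving_prod_add volume volume).quasiMeasurePreserving
  have h1 : AEStronglyMeasurable (fun p : ℝ × ℝ => u (p.1 + p.2))
      ((volume : Measure ℝ).prod volume) := hu.comp_quasiMeasurePreserving hadd
  have h2 : AEStronglyMeasurable (fun p : ℝ × ℝ => u p.1)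
      ((volume : Measure ℝ).prod volume) := hu.comp_fst
  have h3 : AEStronglyMeasurable (fun p : ℝ × ℝ => v p.1)
      ((volume : Measure ℝ).prod volume) := hv.comp_fst
  refine (((Continuous.aestronglyMeasurable ?_).mul h1).sub h2).sub
    ((Continuous.aestronglyMeasurable ?_).mul h3)
  · fun_prop
  · fun_prop

/-- For fixed `y`, Cauchy–Schwarz in `x` and the Plancherel bound give a multiple of `jumpWeight β σ
y`. The factor `φ` is essential: the bound on the jump is in `L²`, not pointwise. -/
theorem integrable_mul_dampedJump (h1 : 1 ≤ σ) (h2 : σ ≤ 2) (hμm : Measurable μ)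
    (hμ : Integrable fun y => jumpWeight β σ y * μ y)
    (hu : MemLp u 2 (volume : Measure ℝ)) (hv : MemLp v 2 (volume : Measure ℝ))
    (huv : ∀ᵐ ξ : ℝ, (𝓕 (hv.toLp v) : Lp ℂ 2 (volume : Measure ℝ)) ξ =
      (β + 2 * Real.pi * ξ * Complex.I) * (𝓕 (hu.toLp u) : Lp ℂ 2 (volume : Measure ℝ)) ξ)
    (hW : MemLp (fun ξ : ℝ => ((1 + ‖(β + 2 * Real.pi * ξ * Complex.I : ℂ)‖) ^ σ : ℝ) *
      (𝓕 (hu.toLp u) : Lp ℂ 2 (volume : Measure ℝ)) ξ) 2)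
    {φ : ℝ → ℂ} (hφ : MemLp φ 2 (volume : Measure ℝ)) :
    Integrable (fun p : ℝ × ℝ => φ p.1 * (dampedJump β u v p.1 p.2 * (μ p.2 : ℂ)))
      ((volume : Measure ℝ).prod volume) := by
  have hmeas : AEStronglyMeasurable
      (fun p : ℝ × ℝ => φ p.1 * (dampedJump β u v p.1 p.2 * (μ p.2 : ℂ)))
      ((volume : Measure ℝ).prod volume) := by
    have hm2 : Measurable fun p : ℝ × ℝ => (μ p.2 : ℂ) := by fun_prop
    exact hφ.1.comp_fst.mul
      ((aestronglyMeasurable_dampedJump hu.1 hv.1).mul hm2.aestronglyMeasurable)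
  refine (integrable_prod_iff' hmeas).2 ⟨Filter.Eventually.of_forall fun y => ?_, ?_⟩
  · have := (hφ.integrable_mul (memLp_dampedJump (β := β) hu hv y)).mul_const (μ y : ℂ)
    simpa [mul_assoc] using this
  · refine (hμ.norm.const_mul ((eLpNorm φ 2 volume).toReal * ‖hW.toLp _‖)).mono'
      hmeas.norm.prod_swap.integral_prod_right' (Filter.Eventually.of_forall fun y => ?_)
    have e : ∀ x, ‖φ x * (dampedJump β u v x y * (μ y : ℂ))‖ =
        ‖φ x * dampedJump β u v x y‖ * |μ y| := by
      intro x
      rw [← mul_assoc, norm_mul, Complex.norm_real, Real.norm_eq_abs]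
    simp only [e]
    rw [integral_mul_const, Real.norm_of_nonneg (by positivity), norm_mul,
      Real.norm_of_nonneg (jumpWeight_nonneg β σ y), Real.norm_eq_abs]
    have b1 := integral_norm_mul_le hφ (memLp_dampedJump (β := β) hu hv y)
    have b2 := toReal_eLpNorm_dampedJump_le h1 h2 hu hv huv hW y
    calc _ ≤ (eLpNorm φ 2 volume).toReal * (jumpWeight β σ y * ‖hW.toLp _‖) * |μ y| := by
          gcongr
          exact b1.trans (by gcongr)
      _ = _ := by ring

theorem measurable_jumpSymbol : Measurable fun p : ℂ × ℝ => jumpSymbol p.1 p.2 := by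
  unfold jumpSymbol
  fun_prop

theorem integrable_jumpSymbol_mul (h1 : 1 ≤ σ) (h2 : σ ≤ 2) (hμm : Measurable μ)
    {z : ℂ} (hμ : Integrable fun y => jumpWeight z.re σ y * μ y) :
    Integrable fun y => jumpSymbol z y * (μ y : ℂ) := by
  refine (hμ.norm.const_mul ((1 + ‖z‖) ^ σ)).mono' ?_ (Filter.Eventually.of_forall fun y => ?_)
  · have := measurable_jumpSymbol.comp (measurable_const (a := z) |>.prodMk measurable_id)
    exact (this.mul (by fun_prop : Measurable fun y => (μ y : ℂ))).aestronglyMeasurable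
  · rw [norm_mul, norm_mul, Complex.norm_real, Real.norm_of_nonneg (jumpWeight_nonneg _ σ y),
      ← mul_assoc]
    gcongr
    rw [mul_comm]
    exact norm_jumpSymbol_le h1 h2 z y

/-- Testing against smooth functions reduces the identity to two applications of Fubini, in `(x, y)`
and in `(y, ξ)`, joined by the Fourier pairing for fixed `y`. -/
theorem ae_integral_dampedJump_eq (h1 : 1 ≤ σ) (h2 : σ ≤ 2) (hμm : Measurable μ)
    (hμ : Integrable fun y => jumpWeight β σ y * μ y)
    (hu : MemLp u 2 (volume : Measure ℝ)) (hv : MemLp v 2 (volume : Measure ℝ))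
    (huv : ∀ᵐ ξ : ℝ, (𝓕 (hv.toLp v) : Lp ℂ 2 (volume : Measure ℝ)) ξ =
      (β + 2 * Real.pi * ξ * Complex.I) * (𝓕 (hu.toLp u) : Lp ℂ 2 (volume : Measure ℝ)) ξ)
    (hW : MemLp (fun ξ : ℝ => ((1 + ‖(β + 2 * Real.pi * ξ * Complex.I : ℂ)‖) ^ σ : ℝ) *
      (𝓕 (hu.toLp u) : Lp ℂ 2 (volume : Measure ℝ)) ξ) 2)
    {h : Lp ℂ 2 (volume : Measure ℝ)}
    (hh : ∀ᵐ ξ : ℝ, (𝓕 h : Lp ℂ 2 (volume : Measure ℝ)) ξ =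
      (∫ y, jumpSymbol (β + 2 * Real.pi * ξ * Complex.I) y * (μ y : ℂ)) *
        (𝓕 (hu.toLp u) : Lp ℂ 2 (volume : Measure ℝ)) ξ) :
    ∀ᵐ x : ℝ, Integrable (fun y => dampedJump β u v x y * (μ y : ℂ)) ∧
      ∫ y, dampedJump β u v x y * (μ y : ℂ) = h x := by
  have hI := fun {φ : ℝ → ℂ} (hφ : MemLp φ 2 (volume : Measure ℝ)) =>
    integrable_mul_dampedJump h1 h2 hμm hμ hu hv huv hW hφ
  -- A nowhere vanishing square integrable function gives integrability for almost every `x`.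
  set ρ : ℝ → ℂ := fun x => ((1 + x ^ 2 : ℝ)⁻¹ : ℝ) with hρ
  have hρ0 : ∀ x, ρ x ≠ 0 := fun x => by
    have : (1 + x ^ 2 : ℝ) ≠ 0 := by positivity
    simpa [hρ] using (by exact_mod_cast this : (1 + (x : ℂ) ^ 2) ≠ 0)
  have hρm : MemLp ρ 2 (volume : Measure ℝ) := by
    have hc : Continuous fun x : ℝ => (1 + x ^ 2 : ℝ)⁻¹ :=
      Continuous.inv₀ (by fun_prop) fun x => by positivity
    refine MemLp.ofReal ((memLp_two_iff_integrable_sq hc.aestronglyMeasurable).2 ?_)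
    refine integrable_inv_one_add_sq.mono' (hc.pow 2).aestronglyMeasurable
      (Filter.Eventually.of_forall fun x => ?_)
    have hle : (1 + x ^ 2 : ℝ)⁻¹ ≤ 1 := inv_le_one_of_one_le₀ (by nlinarith)
    have hnn : 0 ≤ (1 + x ^ 2 : ℝ)⁻¹ := by positivity
    rw [Real.norm_of_nonneg (by positivity)]
    nlinarith
  have hint : ∀ᵐ x : ℝ, Integrable (fun y => dampedJump β u v x y * (μ y : ℂ)) := by
    filter_upwards [(hI hρm).prod_right_ae] with x hx
    have := hx.const_mul (ρ x)⁻¹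
    simpa [← mul_assoc, inv_mul_cancel₀ (hρ0 x)] using this
  have hloc : LocallyIntegrable fun x => ∫ y, dampedJump β u v x y * (μ y : ℂ) := by
    have h3 := (hI hρm).integral_prod_left.locallyIntegrable
    have hc : Continuous fun x => (ρ x)⁻¹ := by
      simp only [hρ, Complex.ofReal_inv, inv_inv]
      fun_prop
    refine (h3.continuous_mul hc).congr (Filter.Eventually.of_forall fun x => ?_)
    simp only [integral_const_mul]
    rw [← mul_assoc, inv_mul_cancel₀ (hρ0 x), one_mul]
  refine hint.and ?_
  refine ae_eq_of_integral_contDiff_smul_eq hloc ((Lp.memLp h).locallyIntegrable (by norm_num)) ?_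
  intro g hg hgc
  have hg₁ : HasCompactSupport (Complex.ofRealCLM ∘ g) := hgc.comp_left rfl
  have hg₂ : ContDiff ℝ ∞ (Complex.ofRealCLM ∘ g) := by fun_prop
  set φ : 𝓢(ℝ, ℂ) := hg₁.toSchwartzMap hg₂
  have hφx : ∀ x (c : ℂ), g x • c = φ x * c := fun x c => Complex.real_smul
  set û : ℝ → ℂ := ((𝓕 (hu.toLp u) : Lp ℂ 2 (volume : Measure ℝ)) : ℝ → ℂ)
  set Z : ℝ → ℂ := fun ξ => β + 2 * Real.pi * ξ * Complex.I with hZ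
  have hZm : Measurable Z := by
    simp only [hZ]
    fun_prop
  have hswap : Integrable (Function.uncurry fun (y ξ : ℝ) =>
      (𝓕⁻ φ) ξ * (jumpSymbol (Z ξ) y * (μ y : ℂ) * û ξ)) ((volume : Measure ℝ).prod volume) := by
    -- The symbol bound separates the variables: weight times `μ` in `y`, and a product of two `L²`
    -- functions in `ξ`.
    have hb := hμ.norm.mul_prod (((𝓕⁻ φ).memLp 2 volume).integrable_mul hW).norm
    refine hb.mono' ?_ (Filter.Eventually.of_forall fun ⟨y, ξ⟩ => ?_)
    · have m1 : Measurable fun p : ℝ × ℝ => jumpSymbol (Z p.2) p.1 :=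
        measurable_jumpSymbol.comp ((hZm.comp measurable_snd).prodMk measurable_fst)
      have m2 : Measurable fun p : ℝ × ℝ => (μ p.1 : ℂ) := by fun_prop
      have m3 : AEStronglyMeasurable (fun p : ℝ × ℝ => û p.2)
          ((volume : Measure ℝ).prod volume) := (Lp.memLp (𝓕 (hu.toLp u))).1.comp_snd
      have m4 : Continuous fun p : ℝ × ℝ => (𝓕⁻ φ) p.2 := (𝓕⁻ φ).continuous.comp continuous_snd
      exact m4.aestronglyMeasurable.mul ((m1.mul m2).aestronglyMeasurable.mul m3)
    · have hk := norm_jumpSymbol_le h1 h2 (Z ξ) y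
      have hre : (Z ξ).re = β := by simp [hZ]
      rw [hre] at hk
      simp only [Function.uncurry_apply_pair, norm_mul, Complex.norm_real, Pi.mul_apply,
        Real.norm_of_nonneg (jumpWeight_nonneg β σ y)]
      rw [Real.norm_of_nonneg (by positivity : (0 : ℝ) ≤
        (1 + ‖(β + 2 * Real.pi * ξ * Complex.I : ℂ)‖) ^ σ)]
      calc _ ≤ ‖(𝓕⁻ φ) ξ‖ * (jumpWeight β σ y * (1 + ‖Z ξ‖) ^ σ * ‖μ y‖ * ‖û ξ‖) := by gcongr
        _ = _ := by simp only [hZ]; ring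
  calc ∫ x, g x • ∫ y, dampedJump β u v x y * (μ y : ℂ)
      = ∫ x, ∫ y, φ x * (dampedJump β u v x y * (μ y : ℂ)) := by
        simp only [hφx, integral_const_mul]
    _ = ∫ y, ∫ x, φ x * (dampedJump β u v x y * (μ y : ℂ)) :=
        integral_integral_swap (hI (φ.memLp 2 volume))
    _ = ∫ y, ∫ ξ, (𝓕⁻ φ) ξ * (jumpSymbol (Z ξ) y * (μ y : ℂ) * û ξ) := by
        congr 1
        ext y
        have e1 := integral_schwartz_mul_eq_integral_fourierInv_mul_fourier
          ((memLp_dampedJump (β := β) hu hv y).toLp _) φ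
        have e2 : ∫ x, φ x * ((memLp_dampedJump (β := β) hu hv y).toLp _ : ℝ → ℂ) x =
            ∫ x, φ x * dampedJump β u v x y := by
          refine integral_congr_ae ?_
          filter_upwards [(memLp_dampedJump (β := β) hu hv y).coeFn_toLp] with x hx
          rw [hx]
        have e3 : ∫ ξ, (𝓕⁻ φ) ξ * (𝓕 ((memLp_dampedJump (β := β) hu hv y).toLp _) :
            Lp ℂ 2 (volume : Measure ℝ)) ξ = ∫ ξ, (𝓕⁻ φ) ξ * (jumpSymbol (Z ξ) y * û ξ) := by
          refine integral_congr_ae ?_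
          filter_upwards [fourier_dampedJump hu hv huv y] with ξ hξ
          rw [hξ]
        rw [e2, e3] at e1
        simp only [← mul_assoc, integral_mul_const] at e1 ⊢
        rw [e1, ← integral_mul_const]
        refine integral_congr_ae (Filter.Eventually.of_forall fun ξ => ?_)
        ring
    _ = ∫ ξ, ∫ y, (𝓕⁻ φ) ξ * (jumpSymbol (Z ξ) y * (μ y : ℂ) * û ξ) :=
        integral_integral_swap hswap
    _ = ∫ ξ, (𝓕⁻ φ) ξ * (𝓕 h : Lp ℂ 2 (volume : Measure ℝ)) ξ := by
        refine integral_congr_ae ?_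
        filter_upwards [hh] with ξ hξ
        rw [hξ, integral_const_mul, integral_mul_const]
    _ = ∫ x, g x • h x := by
        rw [← integral_schwartz_mul_eq_integral_fourierInv_mul_fourier]
        simp only [hφx]

end Jump

/-! ### Multiplication by the symbol of a jump operator -/

section SymbolMul

variable {β σ : ℝ} {μ : ℝ → ℝ} {w : ℝ → ℂ}

theorem memLp_integral_jumpSymbol_mul (h1 : 1 ≤ σ) (h2 : σ ≤ 2) (hμm : Measurable μ)
    (hμ : Integrable fun y => jumpWeight β σ y * μ y)
    (hw : AEStronglyMeasurable w (volume : Measure ℝ))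
    (hW : MemLp (fun ξ : ℝ => ((1 + ‖(β + 2 * Real.pi * ξ * Complex.I : ℂ)‖) ^ σ : ℝ) * w ξ) 2) :
    MemLp (fun ξ : ℝ => (∫ y, jumpSymbol (β + 2 * Real.pi * ξ * Complex.I) y * (μ y : ℂ)) * w ξ)
      2 := by
  refine hW.of_le_mul (c := ∫ y, ‖jumpWeight β σ y * μ y‖) ?_
    (Filter.Eventually.of_forall fun ξ => ?_)
  · have m1 : Measurable fun p : ℝ × ℝ =>
        jumpSymbol (β + 2 * Real.pi * p.1 * Complex.I) p.2 * (μ p.2 : ℂ) :=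
      (measurable_jumpSymbol.comp ((by fun_prop : Measurable fun p : ℝ × ℝ =>
        (β + 2 * Real.pi * p.1 * Complex.I : ℂ)).prodMk measurable_snd)).mul (by fun_prop)
    exact m1.stronglyMeasurable.integral_prod_right.aestronglyMeasurable.mul hw
  · set z : ℂ := β + 2 * Real.pi * ξ * Complex.I with hz
    have hre : z.re = β := by simp [hz]
    rw [norm_mul, norm_mul, Complex.norm_real, Real.norm_of_nonneg (by positivity), ← mul_assoc]
    gcongr
    rw [← integral_mul_const]
    refine norm_integral_le_of_norm_le (hμ.norm.mul_const _)
      (Filter.Eventually.of_forall fun y => ?_)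
    have hk := norm_jumpSymbol_le h1 h2 z y
    rw [hre] at hk
    rw [norm_mul, norm_mul, Complex.norm_real, Real.norm_of_nonneg (jumpWeight_nonneg β σ y),
      mul_right_comm]
    gcongr

theorem memLp_line_mul (h1 : 1 ≤ σ) (hw : AEStronglyMeasurable w (volume : Measure ℝ))
    (hW : MemLp (fun ξ : ℝ => ((1 + ‖(β + 2 * Real.pi * ξ * Complex.I : ℂ)‖) ^ σ : ℝ) * w ξ) 2) :
    MemLp (fun ξ : ℝ => (β + 2 * Real.pi * ξ * Complex.I) * w ξ) 2 := by
  refine hW.of_le ?_ (Filter.Eventually.of_forall fun ξ => ?_)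
  · exact (by fun_prop : Continuous fun ξ : ℝ =>
      (β + 2 * Real.pi * ξ * Complex.I : ℂ)).aestronglyMeasurable.mul hw
  · rw [norm_mul, norm_mul, Complex.norm_real, Real.norm_of_nonneg (by positivity)]
    gcongr
    set z : ℂ := β + 2 * Real.pi * ξ * Complex.I
    exact (by linarith : ‖z‖ ≤ 1 + ‖z‖).trans
      (Real.self_le_rpow_of_one_le (by linarith [norm_nonneg z]) h1)

theorem memLp_one_add_norm_line_rpow_mul (h0 : 0 ≤ σ)
    (hw : AEStronglyMeasurable w (volume : Measure ℝ))
    (hS : MemLp (fun ξ : ℝ => (((1 + ξ ^ 2) ^ (σ / 2) : ℝ) : ℂ) * w ξ) 2) :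
    MemLp (fun ξ : ℝ => ((1 + ‖(β + 2 * Real.pi * ξ * Complex.I : ℂ)‖) ^ σ : ℝ) * w ξ) 2 := by
  -- The constant comes from `1 + ‖z‖ ≤ 1 + |β| + 2π|ξ|`, as `1` and `|ξ|` are both at most `√(1 +
  -- ξ²)`.
  refine hS.of_le_mul (c := (1 + |β| + 2 * Real.pi) ^ σ) ?_
    (Filter.Eventually.of_forall fun ξ => ?_)
  · have hc : Continuous fun ξ : ℝ =>
        (((1 + ‖(β + 2 * Real.pi * ξ * Complex.I : ℂ)‖) ^ σ : ℝ) : ℂ) :=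
      Complex.continuous_ofReal.comp (Continuous.rpow_const (by fun_prop) fun _ => Or.inr h0)
    exact hc.aestronglyMeasurable.mul hw
  · rw [norm_mul, norm_mul, Complex.norm_real, Complex.norm_real,
      Real.norm_of_nonneg (by positivity), Real.norm_of_nonneg (by positivity), ← mul_assoc]
    gcongr
    rw [show σ / 2 = (1 / 2) * σ by ring, Real.rpow_mul (by positivity), ← Real.sqrt_eq_rpow,
      ← Real.mul_rpow (by positivity) (by positivity)]
    gcongr
    have hs1 : 1 ≤ √(1 + ξ ^ 2) := Real.one_le_sqrt.2 (by nlinarith)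
    have hs2 : |ξ| ≤ √(1 + ξ ^ 2) := Real.abs_le_sqrt (by nlinarith)
    have hn : ‖(β + 2 * Real.pi * ξ * Complex.I : ℂ)‖ ≤ |β| + 2 * Real.pi * |ξ| := by
      refine (norm_add_le _ _).trans_eq ?_
      simp [abs_of_pos Real.pi_pos]
    have hp := Real.pi_pos
    nlinarith [abs_nonneg β, mul_le_mul_of_nonneg_left hs1 (abs_nonneg β),
      mul_le_mul_of_nonneg_left hs2 hp.le]

end SymbolMul

/-! ### The tempered stable Lévy density -/

section Levy

variable {lamL νL αL lamR νR αR : ℝ}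

theorem levyDensity_of_pos {y : ℝ} (hy : 0 < y) :
    levyDensity lamL νL αL lamR νR αR y = lamR * tsDensity νR αR y := by
  simp [levyDensity, tsDensity, hy, hy.not_gt, abs_of_pos hy]

theorem levyDensity_neg {y : ℝ} (hy : 0 < y) :
    levyDensity lamL νL αL lamR νR αR (-y) = lamL * tsDensity νL αL y := by
  simp [levyDensity, tsDensity, hy, hy.not_gt, abs_of_pos hy]

theorem measurable_levyDensity : Measurable (levyDensity lamL νL αL lamR νR αR) := by
  unfold levyDensity
  refine Measurable.add ?_ ?_
  · exact Measurable.ite measurableSet_Iio (by fun_prop) measurable_const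
  · exact Measurable.ite measurableSet_Ioi (by fun_prop) measurable_const

theorem integrable_of_integrableOn_Ioi {E : Type*} [NormedAddCommGroup E] {g : ℝ → E}
    (h1 : IntegrableOn g (Set.Ioi 0)) (h2 : IntegrableOn (fun y => g (-y)) (Set.Ioi 0)) :
    Integrable g := by
  have h3 : IntegrableOn g (Set.Iio 0) := by
    have h4 := (Measure.measurePreserving_neg (volume : Measure ℝ)).integrableOn_comp_preimage
      (Homeomorph.neg ℝ).measurableEmbedding (f := g) (s := Set.Iio 0)
    rw [Set.neg_preimage, Set.neg_Iio, neg_zero] at h4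
    exact h4.1 h2
  rw [← integrableOn_univ, ← Set.Iic_union_Ioi (a := (0 : ℝ))]
  exact ((integrableOn_Iic_iff_integrableOn_Iio (by simp)).2 h3).union h1

theorem integral_eq_integral_Ioi_add {g : ℝ → ℂ} (hg : Integrable g) :
    ∫ y, g y = (∫ y in Set.Ioi (0 : ℝ), g y) + ∫ y in Set.Ioi (0 : ℝ), g (-y) := by
  rw [← intervalIntegral.integral_Iic_add_Ioi (b := 0) hg.integrableOn hg.integrableOn,
    integral_comp_neg_Ioi, neg_zero, add_comm]

/-- At `0` convergence needs `α < σ`. At infinity the terms `1`, `e^{βy}` and `e^y` of the weight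
need `ν_R > 0`, `ν_R > β`, `ν_R > 1` on the right, and `ν_L > 0`, `ν_L > -β`, `ν_L > -1` on the
left. -/
theorem integrable_jumpWeight_mul_levyDensity {β σ : ℝ} (hνL : 0 < νL) (hνR : 1 < νR)
    (hβL : 0 < νL + β) (hβR : 0 < νR - β) (hσL : αL < σ) (hσR : αR < σ) :
    Integrable fun y => jumpWeight β σ y * levyDensity lamL νL αL lamR νR αR y := by
  refine integrable_of_integrableOn_Ioi ?_ ?_
  · have i1 := (integrableOn_rpow_mul_tsDensity hσR (by linarith : 0 < νR)).const_mul (lamR * 4)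
    have i2 := (integrableOn_rpow_mul_exp_mul_tsDensity hσR (by linarith : β < νR)).const_mul
      (lamR * 2)
    have i3 := (integrableOn_rpow_mul_exp_mul_tsDensity hσR hνR).const_mul (lamR * 2)
    refine IntegrableOn.congr_fun ((i1.add i2).add i3) (fun y hy => ?_) measurableSet_Ioi
    simp only [Pi.add_apply, jumpWeight, levyDensity_of_pos hy, abs_of_pos hy.out, one_mul]
    ring
  · have i1 := (integrableOn_rpow_mul_tsDensity hσL hνL).const_mul (lamL * 4)
    have i2 := (integrableOn_rpow_mul_exp_mul_tsDensity hσL (by linarith : -β < νL)).const_mul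
      (lamL * 2)
    have i3 := (integrableOn_rpow_mul_exp_mul_tsDensity hσL (by linarith : -1 < νL)).const_mul
      (lamL * 2)
    refine IntegrableOn.congr_fun ((i1.add i2).add i3) (fun y hy => ?_) measurableSet_Ioi
    simp only [Pi.add_apply, jumpWeight, levyDensity_neg hy, abs_neg, abs_of_pos hy.out, mul_neg,
      neg_mul, one_mul]
    ring

/-- The symbol of a one-sided jump operator with Lévy density `tsDensity ν α`; the direction of
the jumps is given by the sign of `c`. -/
def halfSymbol (c ν α : ℝ) (w : ℂ) : ℂ :=
  ∫ y in Set.Ioi (0 : ℝ), (Complex.exp (w * y) - 1 - w / c * (Complex.exp (c * y) - 1))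
    * (tsDensity ν α y : ℂ)

theorem integral_jumpSymbol_mul_levyDensity {σ : ℝ} (h1 : 1 ≤ σ) (h2 : σ ≤ 2) {z : ℂ}
    (hμ : Integrable fun y => jumpWeight z.re σ y * levyDensity lamL νL αL lamR νR αR y) :
    ∫ y, jumpSymbol z y * (levyDensity lamL νL αL lamR νR αR y : ℂ) =
      lamR * halfSymbol 1 νR αR z + lamL * halfSymbol (-1) νL αL (-z) := by
  rw [integral_eq_integral_Ioi_add (integrable_jumpSymbol_mul h1 h2 measurable_levyDensity hμ),
    halfSymbol, halfSymbol, ← integral_const_mul, ← integral_const_mul]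
  congr 1
  · refine setIntegral_congr_fun measurableSet_Ioi fun y hy => ?_
    simp only [levyDensity_of_pos hy, jumpSymbol]
    push_cast
    rw [div_one, one_mul]
    ring
  · refine setIntegral_congr_fun measurableSet_Ioi fun y hy => ?_
    simp only [levyDensity_neg hy, jumpSymbol]
    push_cast
    rw [neg_div_neg_eq, div_one, neg_one_mul, mul_neg, neg_mul]
    ring

end Levy

/-! ### The jump operators through their symbols -/

/-- Turns the coefficient of `∇` for `α = 1` into `ν log ν - (ν-1) log (ν-1)`, the form produced by
the integral. -/
theorem arcoth_one_sub_two_mul {ν : ℝ} (hν : 1 < ν) :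
    2 * arcoth (1 - 2 * ν) = Real.log (ν - 1) - Real.log ν := by
  have h1 : (0 : ℝ) < ν - 1 := by linarith
  have h2 : (0 : ℝ) < 2 * ν - 1 := by linarith
  have h3 : (1 - 2 * ν) ≠ 0 := by linarith
  have e : (1 + (1 - 2 * ν)⁻¹) / (1 - (1 - 2 * ν)⁻¹) = (ν - 1) / ν := by
    have h4 : 1 - (1 - 2 * ν)⁻¹ ≠ 0 := by
      rw [sub_ne_zero]
      intro h
      have := inv_eq_one.1 h.symm
      linarith
    rw [div_eq_div_iff h4 (by linarith)]
    field_simp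
    ring
  have hpos : 0 ≤ (ν - 1) / ν := by positivity
  rw [arcoth, Real.artanh, e, Real.log_sqrt hpos, Real.log_div h1.ne' (by linarith)]
  ring

theorem Gamma_neg_ne_zero {α : ℝ} (hα : α < 2) (h0 : α ≠ 0) (h1 : α ≠ 1) :
    Real.Gamma (-α) ≠ 0 := by
  refine Real.Gamma_ne_zero fun m hm => ?_
  have hm' : α = m := neg_inj.1 hm
  subst hm'
  have : m < 2 := by exact_mod_cast hα
  interval_cases m <;> simp_all

/-- The domain of a sum is an intersection, so `f` must lie in the domain of each summand. The
closed form is therefore solved for the power or logarithm, whose value at `f` becomes a combination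
of `g`, `f` and `∇f`. For a power this divides by `Γ(-α)`, hence `Gamma_neg_ne_zero`. -/
theorem mem_graph_opR {β lam ν α : ℝ} (hν : 1 < ν) (hα : α < 2) (hβ : 0 < ν - β)
    {f g gz : L2exp β} (hg : (f, g) ∈ fnGraph β (halfSymbol 1 ν α))
    (hz : (f, gz) ∈ fnGraph β fun z => z) :
    (f, (lam : ℂ) • g) ∈ (opR β lam ν α).graph := by
  have hν0 : 0 < ν := by linarith
  have hre : ∀ z : ℂ, z.re = β → z.re < ν := fun z h => by linarith
  have hgrad := mem_graph_grad hz
  unfold opR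
  split_ifs with h0 h1
  · subst h0
    have hm : (f, ((Real.log ν : ℝ) : ℂ) • f + ((Real.log ((ν - 1) / ν) : ℝ) : ℂ) • gz
        + (-1 : ℂ) • g) ∈ fnGraph β fun z => Complex.log (ν - z) := by
      refine fnGraph_congr (fnGraph_add (fnGraph_add (fnGraph_smul _ (fnGraph_one f))
        (fnGraph_smul _ hz)) (fnGraph_smul (-1) hg)) fun z hzβ => ?_
      rw [halfSymbol, integral_compensated_mul_tsDensity_zero hν0 one_ne_zero hν (hre z hzβ)]
      push_cast
      ring
    have hgr := mem_graph_real_smul lam (mem_graph_add (mem_graph_sub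
      (mem_graph_scalarOp (Real.log ν) f) (mem_graph_fnOp hm)) (mem_graph_real_smul (Real.log ((ν - 1) / ν)) hgrad))
    have e : ((Real.log ν : ℝ) : ℂ) • f - (((Real.log ν : ℝ) : ℂ) • f
        + ((Real.log ((ν - 1) / ν) : ℝ) : ℂ) • gz + (-1 : ℂ) • g)
        + ((Real.log ((ν - 1) / ν) : ℝ) : ℂ) • gz = g := by
      module
    rwa [e] at hgr
  · subst h1
    set d := Real.log (ν - 1) - 2 * ν * arcoth (1 - 2 * ν) with hd
    have hd' : d = ν * Real.log ν - (ν - 1) * Real.log (ν - 1) := by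
      rw [hd]
      linear_combination -ν * arcoth_one_sub_two_mul hν
    have hm : (f, g + ((ν * Real.log ν : ℝ) : ℂ) • f + ((-d : ℝ) : ℂ) • gz) ∈
        fnGraph β fun z => (ν - z) * Complex.log (ν - z) := by
      refine fnGraph_congr (fnGraph_add (fnGraph_add hg (fnGraph_smul _ (fnGraph_one f)))
        (fnGraph_smul _ hz)) fun z hzβ => ?_
      rw [halfSymbol, integral_compensated_mul_tsDensity_one hν0 one_ne_zero hν (hre z hzβ), hd']
      push_cast
      ring
    have hgr := mem_graph_real_smul lam (mem_graph_add (mem_graph_sub (mem_graph_fnOp hm)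
      (mem_graph_scalarOp (ν * Real.log ν) f)) (mem_graph_real_smul d hgrad))
    have e : g + ((ν * Real.log ν : ℝ) : ℂ) • f + ((-d : ℝ) : ℂ) • gz
        - ((ν * Real.log ν : ℝ) : ℂ) • f + (d : ℂ) • gz = g := by
      push_cast
      module
    rwa [e] at hgr
  · set d := ν ^ α - (ν - 1) ^ α with hd
    have hG := Gamma_neg_ne_zero hα h0 h1
    have hG' : (Real.Gamma (-α) : ℂ) ≠ 0 := by exact_mod_cast hG
    have hm : (f, (Real.Gamma (-α) : ℂ)⁻¹ • g + ((ν ^ α : ℝ) : ℂ) • f + ((-d : ℝ) : ℂ) • gz) ∈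
        fnGraph β fun z => (ν - z) ^ (α : ℂ) := by
      refine fnGraph_congr (fnGraph_add (fnGraph_add (fnGraph_smul _ hg)
        (fnGraph_smul _ (fnGraph_one f))) (fnGraph_smul _ hz)) fun z hzβ => ?_
      rw [halfSymbol, integral_compensated_mul_tsDensity_of_ne hν0 hα h0 h1 one_ne_zero hν
        (hre z hzβ), inv_mul_cancel_left₀ hG', hd]
      push_cast
      ring
    have hgr := mem_graph_real_smul (lam * Real.Gamma (-α)) (mem_graph_add (mem_graph_sub
      (mem_graph_fnOp hm) (mem_graph_scalarOp (ν ^ α) f)) (mem_graph_real_smul d hgrad))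
    have e : (Real.Gamma (-α) : ℂ)⁻¹ • g + ((ν ^ α : ℝ) : ℂ) • f + ((-d : ℝ) : ℂ) • gz
        - ((ν ^ α : ℝ) : ℂ) • f + (d : ℂ) • gz = (Real.Gamma (-α) : ℂ)⁻¹ • g := by
      push_cast
      module
    rwa [e, Complex.ofReal_mul, smul_smul, mul_assoc, mul_inv_cancel₀ hG', mul_one] at hgr

theorem mem_graph_opL {β lam ν α : ℝ} (hν : 0 < ν) (hα : α < 2) (hβ : 0 < ν + β)
    {f g gz : L2exp β} (hg : (f, g) ∈ fnGraph β fun z => halfSymbol (-1) ν α (-z))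
    (hz : (f, gz) ∈ fnGraph β fun z => z) :
    (f, (lam : ℂ) • g) ∈ (opL β lam ν α).graph := by
  have hν1 : -1 < ν := by linarith
  have hre : ∀ z : ℂ, z.re = β → (-z).re < ν := fun z h => by rw [Complex.neg_re]; linarith
  have hc : (-1 : ℝ) ≠ 0 := by norm_num
  have hgrad := mem_graph_grad hz
  unfold opL
  split_ifs with h0 h1
  · subst h0
    have hm : (f, ((Real.log ν : ℝ) : ℂ) • f + ((Real.log ((ν + 1) / ν) : ℝ) : ℂ) • gz
        + (-1 : ℂ) • g) ∈ fnGraph β fun z => Complex.log (ν + z) := by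
      refine fnGraph_congr (fnGraph_add (fnGraph_add (fnGraph_smul _ (fnGraph_one f))
        (fnGraph_smul _ hz)) (fnGraph_smul (-1) hg)) fun z hzβ => ?_
      rw [halfSymbol, integral_compensated_mul_tsDensity_zero hν hc hν1 (hre z hzβ),
        sub_neg_eq_add, sub_neg_eq_add]
      push_cast
      ring
    have hgr := mem_graph_real_smul lam (mem_graph_add (mem_graph_sub
      (mem_graph_scalarOp (Real.log ν) f) (mem_graph_fnOp hm)) (mem_graph_real_smul (Real.log ((ν + 1) / ν)) hgrad))
    have e : ((Real.log ν : ℝ) : ℂ) • f - (((Real.log ν : ℝ) : ℂ) • f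
        + ((Real.log ((ν + 1) / ν) : ℝ) : ℂ) • gz + (-1 : ℂ) • g)
        + ((Real.log ((ν + 1) / ν) : ℝ) : ℂ) • gz = g := by
      module
    rwa [e] at hgr
  · subst h1
    set d := (1 + ν) * Real.log ((ν + 1) / ν) with hd
    have hm : (f, g + ((d : ℝ) : ℂ) • gz) ∈
        fnGraph β fun z => (ν + z) * Complex.log ((ν + z) / ν) := by
      refine fnGraph_congr (fnGraph_add hg (fnGraph_smul _ hz)) fun z hzβ => ?_
      have hνz : 0 < (ν + z).re := by
        rw [Complex.add_re, Complex.ofReal_re]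
        linarith
      -- The principal logarithm splits here because `ν` is a positive real.
      have hlog : Complex.log ((ν + z) / ν) = Complex.log (ν + z) - Real.log ν := by
        have hne : (ν : ℂ) + z ≠ 0 := fun h => by simp [h] at hνz
        rw [div_eq_inv_mul, ← Complex.ofReal_inv, Complex.log_ofReal_mul (inv_pos.2 hν) hne,
          Real.log_inv]
        push_cast
        ring
      rw [halfSymbol, integral_compensated_mul_tsDensity_one hν hc hν1 (hre z hzβ), hd,
        Real.log_div (by linarith) hν.ne', hlog, sub_neg_eq_add, sub_neg_eq_add]
      push_cast
      ring
    have hgr := mem_graph_real_smul lam (mem_graph_sub (mem_graph_fnOp hm)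
      (mem_graph_real_smul d hgrad))
    rwa [add_sub_cancel_right] at hgr
  · set d := ν ^ α - (ν + 1) ^ α with hd
    have hG := Gamma_neg_ne_zero hα h0 h1
    have hG' : (Real.Gamma (-α) : ℂ) ≠ 0 := by exact_mod_cast hG
    have hm : (f, (Real.Gamma (-α) : ℂ)⁻¹ • g + ((ν ^ α : ℝ) : ℂ) • f + ((-d : ℝ) : ℂ) • gz) ∈
        fnGraph β fun z => (ν + z) ^ (α : ℂ) := by
      refine fnGraph_congr (fnGraph_add (fnGraph_add (fnGraph_smul _ hg)
        (fnGraph_smul _ (fnGraph_one f))) (fnGraph_smul _ hz)) fun z hzβ => ?_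
      rw [halfSymbol, integral_compensated_mul_tsDensity_of_ne hν hα h0 h1 hc hν1
        (hre z hzβ), inv_mul_cancel_left₀ hG', hd, sub_neg_eq_add, sub_neg_eq_add]
      push_cast
      ring
    have hgr := mem_graph_real_smul (lam * Real.Gamma (-α)) (mem_graph_add (mem_graph_sub
      (mem_graph_fnOp hm) (mem_graph_scalarOp (ν ^ α) f)) (mem_graph_real_smul d hgrad))
    have e : (Real.Gamma (-α) : ℂ)⁻¹ • g + ((ν ^ α : ℝ) : ℂ) • f + ((-d : ℝ) : ℂ) • gz
        - ((ν ^ α : ℝ) : ℂ) • f + (d : ℂ) • gz = (Real.Gamma (-α) : ℂ)⁻¹ • g := by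
      push_cast
      module
    rwa [e, Complex.ofReal_mul, smul_smul, mul_assoc, mul_inv_cancel₀ hG', mul_one] at hgr

/-! ### The jump integral of a Sobolev function -/

theorem IsWeakDeriv.ae_unique {f g g' : ℝ → ℂ} (h : IsWeakDeriv f g) (h' : IsWeakDeriv f g') :
    g =ᵐ[volume] g' := by
  refine ae_eq_of_integral_contDiff_smul_eq h.2.1 h'.2.1 fun φ hφ hc => ?_
  exact neg_inj.1 ((h.2.2 φ hφ hc).symm.trans (h'.2.2 φ hφ hc))

theorem damp_toLp {β : ℝ} {f : ℝ → ℂ} (hf : MemLp f 2 (expMeasure β)) :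
    damp β (hf.toLp f) = (memLp_damp hf).toLp _ := by
  refine Lp.ext ?_
  filter_upwards [coeFn_damp (hf.toLp f), (memLp_damp hf).coeFn_toLp,
    (volume_absolutelyContinuous_expMeasure β).ae_eq hf.coeFn_toLp] with x h1 h2 h3
  rw [h1, h2, h3]

theorem jumpIntegrand_eq_dampedJump (β : ℝ) (μ : ℝ → ℝ) (f D : ℝ → ℂ) (x y : ℝ) :
    jumpIntegrand μ f D x y = (Real.exp (β * x) : ℂ) *
      (dampedJump β (fun x => (Real.exp (-(β * x)) : ℂ) * f x)
        (fun x => (Real.exp (-(β * x)) : ℂ) * D x) x y * (μ y : ℂ)) := by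
  have e1 : (Real.exp (β * x) : ℂ) * Real.exp (-(β * x)) = 1 := by
    rw [← Complex.ofReal_mul, ← Real.exp_add]
    simp
  have e2 : (Real.exp (β * x) : ℂ) * Real.exp (β * y) * Real.exp (-(β * (x + y))) = 1 := by
    rw [← Complex.ofReal_mul, ← Complex.ofReal_mul, ← Real.exp_add, ← Real.exp_add]
    ring_nf
    simp
  rw [jumpIntegrand, dampedJump]
  linear_combination (-f (x + y) * μ y) * e2 + (f x * μ y + (Real.exp y - 1 : ℝ) * D x * μ y) * e1

section Main

variable {lamL νL αL lamR νR αR β s : ℝ}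

theorem jumpIntegral_eq_opR_add_opL (hαL : αL < 2) (hαR : αR < 2) (hνL : 0 < νL) (hνR : 1 < νR)
    (hL : 0 < νL + β) (hR : 0 < νR - β) (hs : 1 ≤ s) (hsL : αL < s) (hsR : αR < s)
    {f : ℝ → ℂ} (hfs : MemExpSobolev β s f) :
    ∃ (D : ℝ → ℂ) (hf : MemLp f 2 (expMeasure β))
      (hA : hf.toLp f ∈ (opR β lamR νR αR + opL β lamL νL αL).domain),
      IsWeakDeriv f D ∧
      ∀ᵐ x : ℝ,
        Integrable (jumpIntegrand (levyDensity lamL νL αL lamR νR αR) f D x) ∧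
        ∫ y, jumpIntegrand (levyDensity lamL νL αL lamR νR αR) f D x y =
          ((opR β lamR νR αR + opL β lamL νL αL) ⟨hf.toLp f, hA⟩ : ℝ → ℂ) x := by
  obtain ⟨hf, hS⟩ := hfs
  obtain ⟨σ, h1, h2, hσs, hσL, hσR⟩ : ∃ σ : ℝ, 1 ≤ σ ∧ σ ≤ 2 ∧ σ ≤ s ∧ αL < σ ∧ αR < σ :=
    -- The remainder bounds stop at order `2`; lowering `s` to it keeps `σ > α` because `α < 2`.
    ⟨min s 2, le_min hs one_le_two, min_le_right _ _, min_le_left _ _, lt_min hsL hαL,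
      lt_min hsR hαR⟩
  set F : L2exp β := hf.toLp f with hF
  have hm : AEStronglyMeasurable (𝓕 (damp β F) : Lp ℂ 2 (volume : Measure ℝ)) volume :=
    (Lp.memLp _).1
  have hW := memLp_one_add_norm_line_rpow_mul (β := β) (by linarith) hm
    (memLp_rpow_mul_fourier_of_memSobolev (hS.mono hσs))
  have hμ := fun lamL lamR : ℝ =>
    integrable_jumpWeight_mul_levyDensity (lamL := lamL) (lamR := lamR) hνL hνR hL hR hσL hσR
  have hψ : ∀ (lamL lamR : ℝ) (z : ℂ), z.re = β →
      ∫ y, jumpSymbol z y * (levyDensity lamL νL αL lamR νR αR y : ℂ) =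
        lamR * halfSymbol 1 νR αR z + lamL * halfSymbol (-1) νL αL (-z) := by
    intro lamL lamR z hz
    exact integral_jumpSymbol_mul_levyDensity h1 h2 (hz ▸ hμ lamL lamR)
  obtain ⟨gz, hgz⟩ : ∃ g, (F, g) ∈ fnGraph β fun z => z :=
    exists_mem_fnGraph (memLp_line_mul h1 hm hW)
  have hsymb : ∀ lamL lamR : ℝ, ∃ g, (F, g) ∈ fnGraph β fun z =>
      ∫ y, jumpSymbol z y * (levyDensity lamL νL αL lamR νR αR y : ℂ) := fun lamL lamR =>
    exists_mem_fnGraph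
      (memLp_integral_jumpSymbol_mul h1 h2 measurable_levyDensity (hμ lamL lamR) hm hW)
  -- Intensities `0` and `1` isolate one side of the density, so each half of the symbol separately
  -- maps `F` into `L²`.
  obtain ⟨gR, hgR⟩ := hsymb 0 1
  obtain ⟨gL, hgL⟩ := hsymb 1 0
  have hgR' : (F, gR) ∈ fnGraph β (halfSymbol 1 νR αR) :=
    fnGraph_congr hgR fun z hz => by rw [hψ 0 1 z hz]; simp
  have hgL' : (F, gL) ∈ fnGraph β fun z => halfSymbol (-1) νL αL (-z) :=
    fnGraph_congr hgL fun z hz => by rw [hψ 1 0 z hz]; simp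
  set G : L2exp β := (lamR : ℂ) • gR + (lamL : ℂ) • gL
  have hgraph : (F, G) ∈ (opR β lamR νR αR + opL β lamL νL αL).graph :=
    mem_graph_add (mem_graph_opR hνR hαR hR hgR' hgz) (mem_graph_opL hνL hαL hL hgL' hgz)
  have hA : F ∈ (opR β lamR νR αR + opL β lamL νL αL).domain :=
    LinearPMap.mem_domain_of_mem_graph hgraph
  have hAG : (opR β lamR νR αR + opL β lamL νL αL) ⟨F, hA⟩ = G :=
    ((LinearPMap.image_iff hA).2 hgraph).symm
  refine ⟨gz, hf, hA, ?_, ?_⟩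
  · have hw : IsWeakDeriv F gz := gradGraph_of_fnGraph hgz
    exact hw.congr
      ((volume_absolutelyContinuous_expMeasure β).ae_eq hf.coeFn_toLp).symm Filter.EventuallyEq.rfl
  rw [hAG]
  have hGψ : (F, G) ∈ fnGraph β fun z =>
      ∫ y, jumpSymbol z y * (levyDensity lamL νL αL lamR νR αR y : ℂ) :=
    fnGraph_congr (fnGraph_add (fnGraph_smul (lamR : ℂ) hgR') (fnGraph_smul (lamL : ℂ) hgL'))
      fun z hz => (hψ lamL lamR z hz).symm
  rw [mem_fnGraph_iff] at hGψ hgz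
  rw [hF, damp_toLp hf] at hGψ hgz hW
  have key := ae_integral_dampedJump_eq h1 h2 measurable_levyDensity (hμ lamL lamR)
    (memLp_damp hf) (memLp_damp (Lp.memLp gz)) hgz hW hGψ
  filter_upwards [key, coeFn_damp G] with x hx hGx
  have e : jumpIntegrand (levyDensity lamL νL αL lamR νR αR) f gz x = fun y => _ :=
    funext fun y => jumpIntegrand_eq_dampedJump β _ f gz x y
  rw [e]
  refine ⟨hx.1.const_mul _, ?_⟩
  rw [integral_const_mul, hx.2, hGx, ← mul_assoc, ← Complex.ofReal_mul, ← Real.exp_add]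
  simp

end Main

theorem proposition2 (lamL νL αL lamR νR αR : ℝ)
    (hlamL : 0 < lamL) (hlamR : 0 < lamR) (hαL : αL < 2) (hαR : αR < 2)
    (hνL : 0 < νL) (hνR : 1 < νR)
    (β : ℝ) (hL : RePos (scalarOp β νL + grad β)) (hR : RePos (scalarOp β νR - grad β))
    (s : ℝ) (hs : 1 ≤ s) (hsL : αL < s) (hsR : αR < s) :
    (∀ f : ℝ → ℂ, MemExpSobolev β s f →
      ∃ (D : ℝ → ℂ) (hf : MemLp f 2 (expMeasure β))
        (hA : hf.toLp f ∈ (opR β lamR νR αR + opL β lamL νL αL).domain),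
        IsWeakDeriv f D ∧
        ∀ᵐ x : ℝ,
          Integrable (jumpIntegrand (levyDensity lamL νL αL lamR νR αR) f D x) ∧
          ∫ y, jumpIntegrand (levyDensity lamL νL αL lamR νR αR) f D x y =
            ((opR β lamR νR αR + opL β lamL νL αL) ⟨hf.toLp f, hA⟩ : ℝ → ℂ) x) ∧
    (∀ (T : ℝ) (C : ℝ → ℝ → ℂ), (∀ τ ∈ Set.Ioo 0 T, MemExpSobolev β s (C τ)) →
      (SolvesPIDE (levyDensity lamL νL αL lamR νR αR) T C ↔
        SolvesPDE (opR β lamR νR αR + opL β lamL νL αL) T C)) := by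
  have main := fun (f : ℝ → ℂ) (hf : MemExpSobolev β s f) =>
    jumpIntegral_eq_opR_add_opL (lamL := lamL) (lamR := lamR) hαL hαR hνL hνR
      (pos_of_rePos_scalarOp_add_grad hL) (pos_of_rePos_scalarOp_sub_grad hR) hs hsL hsR hf
  refine ⟨main, fun T C hC => ⟨fun h τ hτ => ?_, fun h τ hτ => ?_⟩⟩
  · obtain ⟨D, hf, hA, hD, hae⟩ := main (C τ) (hC τ hτ)
    obtain ⟨D', hD', hae'⟩ := h τ hτ
    refine ⟨hf, hA, ?_⟩
    -- The weak derivative enters the integrand only through its value at `x`, so equality at almost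
    -- every `x` makes the integrands agree for all `y`.
    filter_upwards [hae, hae', hD.ae_unique hD'] with x h1 h2 h3
    have e : jumpIntegrand (levyDensity lamL νL αL lamR νR αR) (C τ) D' x =
        jumpIntegrand (levyDensity lamL νL αL lamR νR αR) (C τ) D x := by
      ext y
      rw [jumpIntegrand, jumpIntegrand, h3]
    rw [← h1.2, ← e]
    exact h2.2
  · obtain ⟨D, hf, hA, hD, hae⟩ := main (C τ) (hC τ hτ)
    obtain ⟨hf', hA', hae'⟩ := h τ hτ
    refine ⟨D, hD, ?_⟩
    filter_upwards [hae, hae'] with x h1 h2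
    refine ⟨h1.1, ?_⟩
    rw [h1.2]
    exact h2

end
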